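/- For $t\in(0,1)$ let $\varphi(t)\in(0,2\pi)$ be the unique solution of $\varphi(t)-\sin\varphi(t)=2\pi t$, let $A=\big(\tfrac{3}{8\pi^2}\big)^{1/3}$, and set \[ l(t)=A\,(1-\cos\varphi(t)),\qquad r(t)=\frac{3}{4\,l(t)},\qquad a(t)=\frac{\dot l(t)}{l(t)}=\frac{2\pi\sin\varphi(t)}{(1-\cos\varphi(t))^2},\qquad k(t)=\frac{3\,\varphi(t)}{8\pi A}. \] (Equivalently, $(r,l,a,k)$ is the unique solution on $(0,1)$ of $l>0$, $r\,l=\tfrac34$, $\dot k=r$, $\dot r=-ra$, $\dot a=-\big(a^2+\tfrac{32}{9}r^3\big)$ with $r(t)\to\infty$ as $t\to0^+$ and as $t\to1^-$, and $k(t)\to0$ as $t\to 0^+$.) Define, for $(x,t)\in\mathbb R\times(0,1)$, \[ \overline\rho(x,t)=r(t)\Big(1-\frac{x^2}{l(t)^2}\Big)_+ ,\qquad \overline u(x,t)=k(t)+\tfrac12 a(t)x^2\quad\text{if } |x|\le l(t), \] and, if $|x|>l(t)$, \[ \overline u(x,t)=k(t_0)+\tfrac12 a(t_0)\,l(t_0)^2+\tfrac12\,\dot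 l(t_0)^2\,(t-t_0), \] where $t_0\in(0,t)$ is the unique time with $|x|=l(t_0)+(t-t_0)\,\dot l(t_0)$. (The pair $(\overline u,\overline\rho)$ is the explicit solution of the planning problem $\partial_t\overline u+\tfrac12(\partial_x\overline u)^2=\overline\rho$, $\partial_t\overline\rho+\partial_x(\overline\rho\,\partial_x\overline u)=0$ in $\mathbb R\times(0,1)$, $\overline\rho(\cdot,0)=\overline\rho(\cdot,1)=\delta_0$, $\overline u(0,0)=0$.) Elements of $H^1((0,1))$ are identified with their continuous representatives on $[0,1]$. **Proposition.** (i) For all $0<\theta<t<1$ and $x\in\mathbb R$, \[ \overline u(x,t)=\inf\Big\{\int_\theta^t\Big[\frac{\dot y(s)^2}{2}+\overline\rho(y(s),s)\Big]ds+\overline u(y(\theta),\theta)\;:\;y\in H^1((0,1)),\ y(t)=x\Big\}. \] (ii) For all $(x,t)\in\mathbb R\times(0,1)$, \[ \overline u(x,t)=\inf\Big\{\int_0^t\Big[\frac{\dot y(s)^2}{2}+\overline\rho(y(s),s)\Big]ds\;:\;y\in H^1((0,1)),\ y(t)=x,\ y(0)=0\Big\}. \] (iii) For all $(x,t)\in\mathbb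 R\times(0,1)$, $\ \overline u(x,t)\ge \dfrac{x^2}{2t}$. (iv) Uniformly in $x\in\mathbb R$, $\ \limsup_{t\to0^+}\Big[\overline u(x,t)-\dfrac{x^2}{2t}\Big]\le0$; that is, for every $\varepsilon>0$ there is $\delta\in(0,1]$ such that $\overline u(x,t)-\frac{x^2}{2t}\le\varepsilon$ for all $x\in\mathbb R$ and $0<t<\delta$. -/

import Mathlib

open Real Set Filter Topology MeasureTheory

namespace Planning

/-! ### The profile functions `r`, `l`, `a`, `k` -/

/-- The boundary value problem for the profile functions on `(0,1)`: `ρ̄ = r (1 - (x/l)²)₊` has mass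
one, `r, a, k` solve the ordinary differential equations which express that `ρ̄` and
`ū = k + a x²/2` solve the two equations of the planning problem in `{|x| ≤ l(t)}`, `ρ̄` is
concentrated at `0` at both times `0` and `1`, and `ū(0,0) = 0`. -/
structure IsProfile (r l a k : ℝ → ℝ) : Prop where
  l_pos : ∀ t ∈ Ioo (0 : ℝ) 1, 0 < l t
  mass : ∀ t ∈ Ioo (0 : ℝ) 1, r t * l t = 3 / 4
  k_ode : ∀ t ∈ Ioo (0 : ℝ) 1, HasDerivAt k (r t) t
  r_ode : ∀ t ∈ Ioo (0 : ℝ) 1, HasDerivAt r (-(r t * a t)) t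
  a_ode : ∀ t ∈ Ioo (0 : ℝ) 1, HasDerivAt a (-(a t ^ 2 + 32 / 9 * r t ^ 3)) t
  r_zero : Tendsto r (𝓝[>] 0) atTop
  r_one : Tendsto r (𝓝[<] 1) atTop
  k_zero : Tendsto k (𝓝[>] 0) (𝓝 0)

theorem sub_sin_strictMono : StrictMono fun φ : ℝ => φ - sin φ := by
  intro x y hxy
  have h1 : sin y - sin x = 2 * sin ((y - x) / 2) * cos ((y + x) / 2) := Real.sin_sub_sin y x
  have h2 : 0 < (y - x) / 2 := by linarith
  have h3 : |sin ((y - x) / 2)| < (y - x) / 2 := by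
    have := Real.sin_lt h2
    have h4 : -((y - x) / 2) < sin ((y - x) / 2) := by
      have := Real.neg_one_le_sin ((y-x)/2)
      rcases lt_or_ge 1 ((y-x)/2) with h | h
      · linarith
      · have := Real.sin_pos_of_pos_of_le_one h2 h
        linarith
    exact abs_lt.2 ⟨h4, this⟩
  have h5 : |sin ((y - x) / 2) * cos ((y + x) / 2)| ≤ |sin ((y - x) / 2)| := by
    rw [abs_mul]
    exact mul_le_of_le_one_right (abs_nonneg _) (Real.abs_cos_le_one _)
  have h6 := le_abs_self (sin ((y - x) / 2) * cos ((y + x) / 2))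
  show x - sin x < y - sin y
  nlinarith

theorem sub_sin_surjective : Function.Surjective fun φ : ℝ => φ - sin φ := by
  have hc : Continuous fun φ : ℝ => φ - sin φ := by fun_prop
  refine hc.surjective ?_ ?_
  · refine tendsto_atTop_mono (f := fun φ : ℝ => φ - 1) (fun φ => ?_) ?_
    · have := Real.sin_le_one φ
      linarith
    · exact tendsto_atTop_add_const_right _ _ tendsto_id
  · refine tendsto_atBot_mono (g := fun φ : ℝ => φ - sin φ)
      (f := fun φ : ℝ => φ + 1) (fun φ => ?_) ?_
    · have := Real.neg_one_le_sin φ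
      linarith
    · exact tendsto_atBot_add_const_right _ _ tendsto_id

/-- The increasing bijection `φ ↦ φ - sin φ` of the real line. -/
noncomputable def subSin : ℝ ≃o ℝ :=
  sub_sin_strictMono.orderIsoOfSurjective _ sub_sin_surjective

/-- The phase: the unique solution `φ` of `φ - sin φ = 2 π t`. -/
noncomputable def phase (t : ℝ) : ℝ := subSin.symm (2 * π * t)

/-- The constant `(3 / (8 π²))^(1/3)`. -/
noncomputable def radius : ℝ := (3 / (8 * π ^ 2)) ^ (1 / 3 : ℝ)

/-- The half-width `l` of the support of `ρ̄`. -/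
noncomputable def lBar (t : ℝ) : ℝ := radius * (1 - cos (phase t))

/-- The height `r` of `ρ̄`. -/
noncomputable def rBar (t : ℝ) : ℝ := 3 / (4 * lBar t)

/-- The coefficient `a` of `x²/2` in `ū`. -/
noncomputable def aBar (t : ℝ) : ℝ := 2 * π * sin (phase t) / (1 - cos (phase t)) ^ 2

/-- The value `k` of `ū` at `x = 0`. -/
noncomputable def kBar (t : ℝ) : ℝ := 3 * phase t / (8 * π * radius)

/-! ### The explicit solution `(ρ̄, ū)` -/

/-- The density `ρ̄(x,t) = r(t) (1 - (x/l(t))²)₊`. -/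
noncomputable def rhoBar (x t : ℝ) : ℝ := rBar t * max (1 - (x / lBar t) ^ 2) 0

/-- The time `t₀ ∈ (0,t)` at which the line through `(|x|,t)` that is tangent to the curve
`{(l(s),s)}` touches it. It exists and is unique when `0 < t < 1` and `l(t) < |x|`, see
`existsUnique_tangency`. -/
noncomputable def tangencyTime (x t : ℝ) : ℝ :=
  Classical.epsilon fun t₀ => t₀ ∈ Ioo 0 t ∧ |x| = lBar t₀ + (t - t₀) * deriv lBar t₀

/-- The formula `k(t) + a(t) x²/2` for `ū` in the region `{|x| ≤ l(t)}`. -/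
noncomputable def uInner (x t : ℝ) : ℝ := kBar t + aBar t * x ^ 2 / 2

open Classical in
/-- The function `ū`: the explicit formula in the region `{|x| ≤ l(t)}`, extended to the rest of
`ℝ × (0,1)` along the tangent lines of the boundary of this region (which is symmetric in `x`). -/
noncomputable def uBar (x t : ℝ) : ℝ :=
  if |x| ≤ lBar t then uInner x t
  else uInner (lBar (tangencyTime x t)) (tangencyTime x t)
    + deriv lBar (tangencyTime x t) ^ 2 / 2 * (t - tangencyTime x t)

/-! ### Paths -/

/-- The paths in `H¹((0,1))`, given by their continuous representative on `[0,1]`: absolutely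
continuous functions with a square integrable derivative. -/
def IsH1Path (y : ℝ → ℝ) : Prop :=
  AbsolutelyContinuousOnInterval y 0 1 ∧ MemLp (deriv y) 2 (volume.restrict (Ioo 0 1))

/-- The cost `∫_τ^t [ẏ(s)²/2 + ρ̄(y(s),s)] ds` of a path. -/
noncomputable def cost (y : ℝ → ℝ) (τ t : ℝ) : ℝ :=
  ∫ s in τ..t, (deriv y s ^ 2 / 2 + rhoBar (y s) s)

/-! ### The explicit profile is the unique solution of the boundary value problem -/

theorem phase_eq (t : ℝ) : phase t - sin (phase t) = 2 * π * t :=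
  subSin.apply_symm_apply (2 * π * t)

theorem phase_strictMono : StrictMono phase := by
  intro s t h
  exact subSin.symm.strictMono (by have := Real.pi_pos; nlinarith)

theorem phase_continuous : Continuous phase :=
  subSin.symm.continuous.comp (by fun_prop)

theorem phase_zero : phase 0 = 0 := by
  apply sub_sin_strictMono.injective
  show phase 0 - sin (phase 0) = 0 - sin 0
  rw [phase_eq]; simp

theorem phase_one : phase 1 = 2 * π := by
  apply sub_sin_strictMono.injective
  show phase 1 - sin (phase 1) = 2 * π - sin (2 * π)
  rw [phase_eq]; simp

theorem phase_mem {t : ℝ} (ht : t ∈ Ioo (0 : ℝ) 1) : phase t ∈ Ioo 0 (2 * π) := by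
  constructor
  · rw [← phase_zero]; exact phase_strictMono ht.1
  · rw [← phase_one]; exact phase_strictMono ht.2

theorem one_sub_cos_phase_pos {t : ℝ} (ht : t ∈ Ioo (0 : ℝ) 1) : 0 < 1 - cos (phase t) := by
  have h := phase_mem ht
  have h1 : 0 < sin (phase t / 2) :=
    Real.sin_pos_of_pos_of_lt_pi (by linarith [h.1]) (by linarith [h.2])
  have h2 : cos (phase t) = 1 - 2 * sin (phase t / 2) ^ 2 := by
    have := Real.cos_sq' (phase t / 2)
    have h3 := Real.cos_two_mul (phase t / 2)
    rw [show 2 * (phase t / 2) = phase t by ring] at h3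
    linarith
  rw [h2]; nlinarith

theorem radius_pos : 0 < radius := by unfold radius; positivity

theorem radius_cube : radius ^ 3 = 3 / (8 * π ^ 2) := by
  unfold radius
  rw [← Real.rpow_natCast, ← Real.rpow_mul (by positivity)]
  norm_num

theorem lBar_pos {t : ℝ} (ht : t ∈ Ioo (0 : ℝ) 1) : 0 < lBar t :=
  mul_pos radius_pos (one_sub_cos_phase_pos ht)

theorem hasDerivAt_phase {t : ℝ} (ht : t ∈ Ioo (0 : ℝ) 1) :
    HasDerivAt phase (2 * π / (1 - cos (phase t))) t := by
  have hpos := one_sub_cos_phase_pos ht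
  have h1 : HasDerivAt (fun φ : ℝ => φ - sin φ) (1 - cos (phase t))
      (subSin.symm (2 * π * t)) := (hasDerivAt_id _).sub (Real.hasDerivAt_sin _)
  have h2 : HasDerivAt subSin.symm (1 - cos (phase t))⁻¹ (2 * π * t) :=
    h1.of_local_left_inverse subSin.symm.continuous.continuousAt hpos.ne'
      (Eventually.of_forall fun y => subSin.apply_symm_apply y)
  have h3 : HasDerivAt (fun s : ℝ => 2 * π * s) (2 * π) t := by
    simpa using (hasDerivAt_id t).const_mul (2 * π)
  have h4 := HasDerivAt.comp t h2 h3
  refine h4.congr_deriv ?_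
  rw [div_eq_mul_inv, mul_comm]

theorem hasDerivAt_lBar {t : ℝ} (ht : t ∈ Ioo (0 : ℝ) 1) :
    HasDerivAt lBar (aBar t * lBar t) t := by
  have hpos := one_sub_cos_phase_pos ht
  have h := (((hasDerivAt_phase ht).cos).const_sub 1).const_mul radius
  refine h.congr_deriv ?_
  unfold aBar lBar
  field_simp

theorem lBar_continuous : Continuous lBar := by
  unfold lBar
  have := phase_continuous
  fun_prop

theorem lBar_zero : lBar 0 = 0 := by simp [lBar, phase_zero]

theorem lBar_one : lBar 1 = 0 := by simp [lBar, phase_one]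

theorem tendsto_rBar {c : ℝ} {F : Filter ℝ} (hc : lBar c = 0) (hF : F ≤ 𝓝 c)
    (hF' : ∀ᶠ t in F, t ∈ Ioo (0 : ℝ) 1) : Tendsto rBar F atTop := by
  have h1 : Tendsto lBar F (𝓝[>] 0) := by
    refine tendsto_nhdsWithin_iff.2 ⟨?_, hF'.mono fun t ht => lBar_pos ht⟩
    rw [← hc]
    exact lBar_continuous.continuousAt.tendsto.mono_left hF
  have h2 : Tendsto (fun t => 3 / 4 * (lBar t)⁻¹) F atTop :=
    (tendsto_inv_nhdsGT_zero.comp h1).const_mul_atTop (by norm_num)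
  refine h2.congr fun t => ?_
  unfold rBar
  rw [← div_eq_mul_inv, div_div]

theorem ode_algebra {p s c : ℝ} (hp : p ≠ 0) (hc : 1 - c ≠ 0) (h : s ^ 2 + c ^ 2 = 1) :
    (2 * p * (c * (2 * p / (1 - c))) * (1 - c) ^ 2
        - 2 * p * s * (2 * (1 - c) ^ 1 * -(-s * (2 * p / (1 - c))))) / ((1 - c) ^ 2) ^ 2
      = -((2 * p * s / (1 - c) ^ 2) ^ 2
        + 32 / 9 * (27 / 64 / (3 / (8 * p ^ 2) * (1 - c) ^ 3))) := by
  have h' : s ^ 2 = 1 - c ^ 2 := by linarith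
  field_simp
  rw [h']
  ring

/-- The explicit functions solve the boundary value problem. -/
theorem isProfile_bar : IsProfile rBar lBar aBar kBar where
  l_pos t ht := lBar_pos ht
  mass t ht := by
    have := lBar_pos ht
    unfold rBar
    field_simp
  k_ode t ht := by
    have hpos := one_sub_cos_phase_pos ht
    have hr := radius_pos
    have h := ((hasDerivAt_phase ht).const_mul 3).div_const (8 * π * radius)
    refine h.congr_deriv ?_
    unfold rBar lBar
    field_simp
    norm_num
  r_ode t ht := by
    have hpos := lBar_pos ht
    have h := (((hasDerivAt_lBar ht).const_mul 4).inv (by positivity)).const_mul 3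
    refine (h.congr_deriv ?_).congr_of_eventuallyEq (Eventually.of_forall fun s => ?_)
    · unfold rBar
      field_simp
    · simp [rBar, div_eq_mul_inv]
  a_ode t ht := by
    have hpos := one_sub_cos_phase_pos ht
    have hr := radius_pos
    have hr3 := radius_cube
    have hφ := hasDerivAt_phase ht
    have h := ((hφ.sin).const_mul (2 * π)).div (((hφ.cos).const_sub 1).pow 2)
      (pow_ne_zero 2 hpos.ne')
    refine h.congr_deriv ?_
    have h3 : rBar t ^ 3 = 27 / 64 / (3 / (8 * π ^ 2) * (1 - cos (phase t)) ^ 3) := by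
      rw [← hr3]
      unfold rBar lBar
      field_simp
      norm_num
    rw [h3]
    exact ode_algebra Real.pi_pos.ne' hpos.ne' (Real.sin_sq_add_cos_sq (phase t))
  r_zero := tendsto_rBar lBar_zero nhdsWithin_le_nhds
    (Ioo_mem_nhdsGT (by norm_num))
  r_one := tendsto_rBar lBar_one nhdsWithin_le_nhds
    (Ioo_mem_nhdsLT (by norm_num))
  k_zero := by
    have h : Continuous kBar := by
      unfold kBar
      have := phase_continuous
      fun_prop
    have h0 : kBar 0 = 0 := by simp [kBar, phase_zero]
    have := h.continuousAt (x := 0)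
    rw [ContinuousAt, h0] at this
    exact this.mono_left nhdsWithin_le_nhds

theorem IsProfile.r_pos {r l a k : ℝ → ℝ} (h : IsProfile r l a k) {t : ℝ}
    (ht : t ∈ Ioo (0 : ℝ) 1) : 0 < r t := by
  have h1 := h.mass t ht
  have h2 := h.l_pos t ht
  by_contra hr
  nlinarith

theorem IsProfile.l_eq {r l a k : ℝ → ℝ} (h : IsProfile r l a k) {t : ℝ}
    (ht : t ∈ Ioo (0 : ℝ) 1) : l t = 3 / 4 * (r t)⁻¹ := by
  have h1 := h.mass t ht
  have h2 := h.r_pos ht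
  field_simp
  linarith

theorem IsProfile.hasDerivAt_l {r l a k : ℝ → ℝ} (h : IsProfile r l a k) {t : ℝ}
    (ht : t ∈ Ioo (0 : ℝ) 1) : HasDerivAt l (a t * l t) t := by
  have h2 := h.r_pos ht
  have h3 := ((h.r_ode t ht).inv h2.ne').const_mul (3 / 4)
  refine (h3.congr_deriv ?_).congr_of_eventuallyEq ?_
  · rw [h.l_eq ht]
    field_simp
  · filter_upwards [Ioo_mem_nhds ht.1 ht.2] with s hs using h.l_eq hs

theorem IsProfile.hasDerivAt_dot {r l a k : ℝ → ℝ} (h : IsProfile r l a k) {t : ℝ}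
    (ht : t ∈ Ioo (0 : ℝ) 1) :
    HasDerivAt (fun s => a s * l s) (-(3 / 2) / l t ^ 2) t := by
  have h1 := h.l_pos t ht
  refine ((h.a_ode t ht).mul (h.hasDerivAt_l ht)).congr_deriv ?_
  have h2 : r t = 3 / 4 / l t := by
    rw [eq_div_iff h1.ne']; exact h.mass t ht
  rw [h2]
  field_simp
  ring

theorem IsProfile.tendsto_l {r l a k : ℝ → ℝ} (h : IsProfile r l a k) {F : Filter ℝ}
    (hF : Tendsto r F atTop) (hF' : ∀ᶠ t in F, t ∈ Ioo (0 : ℝ) 1) : Tendsto l F (𝓝 0) := by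
  have h1 : Tendsto (fun t => 3 / 4 * (r t)⁻¹) F (𝓝 (3 / 4 * 0)) :=
    (tendsto_inv_atTop_zero.comp hF).const_mul _
  rw [mul_zero] at h1
  exact h1.congr' (hF'.mono fun t ht => (h.l_eq ht).symm)

theorem IsProfile.l_le {r l a k r' l' a' k' : ℝ → ℝ} (h : IsProfile r l a k)
    (h' : IsProfile r' l' a' k') {t : ℝ} (ht : t ∈ Ioo (0 : ℝ) 1) : l t ≤ l' t := by
  by_contra hlt
  push Not at hlt
  set w : ℝ → ℝ := fun s => l s - l' s with hw
  have hwt : 0 < w t := sub_pos.2 hlt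
  have h0 : Tendsto w (𝓝[>] 0) (𝓝 0) := by
    have e : ∀ᶠ t : ℝ in 𝓝[>] 0, t ∈ Ioo (0 : ℝ) 1 := Ioo_mem_nhdsGT (by norm_num)
    simpa using (h.tendsto_l h.r_zero e).sub (h'.tendsto_l h'.r_zero e)
  have h1 : Tendsto w (𝓝[<] 1) (𝓝 0) := by
    have e : ∀ᶠ t : ℝ in 𝓝[<] 1, t ∈ Ioo (0 : ℝ) 1 := Ioo_mem_nhdsLT (by norm_num)
    simpa using (h.tendsto_l h.r_one e).sub (h'.tendsto_l h'.r_one e)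
  obtain ⟨α, hα, hα'⟩ := (mem_nhdsGT_iff_exists_Ioo_subset).1 (h0.eventually_lt_const hwt)
  obtain ⟨β, hβ, hβ'⟩ := (mem_nhdsLT_iff_exists_Ioo_subset).1 (h1.eventually_lt_const hwt)
  have hα : 0 < α := hα
  have hβ : β < 1 := hβ
  have htα : α ≤ t := by
    by_contra hh
    exact lt_irrefl (w t) (hα' ⟨ht.1, not_le.1 hh⟩)
  have htβ : t ≤ β := by
    by_contra hh
    exact lt_irrefl (w t) (hβ' ⟨not_le.1 hh, ht.2⟩)
  have hsub : ∀ s ∈ Icc α β, s ∈ Ioo (0 : ℝ) 1 := fun s hs =>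
    ⟨lt_of_lt_of_le hα hs.1, lt_of_le_of_lt hs.2 hβ⟩
  have hd : ∀ s ∈ Ioo (0 : ℝ) 1, HasDerivAt w (a s * l s - a' s * l' s) s := fun s hs =>
    (h.hasDerivAt_l hs).sub (h'.hasDerivAt_l hs)
  have hcont : ContinuousOn w (Icc α β) := fun s hs =>
    (hd s (hsub s hs)).continuousAt.continuousWithinAt
  obtain ⟨p, hp, hmax⟩ := isCompact_Icc.exists_isMaxOn ⟨t, htα, htβ⟩ hcont
  have hp01 := hsub p hp
  have hwp : w t ≤ w p := hmax ⟨htα, htβ⟩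
  have hlocmax : IsLocalMax w p := by
    filter_upwards [Ioo_mem_nhds hp01.1 hp01.2] with s hs
    by_cases hs1 : s < α
    · exact (le_of_lt (hα' ⟨hs.1, hs1⟩)).trans hwp
    by_cases hs2 : β < s
    · exact (le_of_lt (hβ' ⟨hs2, hs.2⟩)).trans hwp
    exact hmax ⟨not_lt.1 hs1, not_lt.1 hs2⟩
  have hderiv : deriv w =ᶠ[𝓝 p] fun s => a s * l s - a' s * l' s := by
    filter_upwards [Ioo_mem_nhds hp01.1 hp01.2] with s hs using (hd s hs).deriv
  have hdd : deriv (deriv w) p = -(3 / 2) / l p ^ 2 - -(3 / 2) / l' p ^ 2 := by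
    rw [hderiv.deriv_eq]
    exact ((h.hasDerivAt_dot hp01).sub (h'.hasDerivAt_dot hp01)).deriv
  have hpos : 0 < deriv (deriv w) p := by
    rw [hdd]
    have e1 := h'.l_pos p hp01
    have e2 : l' p < l p := sub_pos.1 (lt_of_lt_of_le hwt hwp)
    have e3 : 1 / l p ^ 2 < 1 / l' p ^ 2 :=
      one_div_lt_one_div_of_lt (by positivity) (by gcongr)
    have e4 : -(3 / 2) / l p ^ 2 - -(3 / 2) / l' p ^ 2
        = 3 / 2 * (1 / l' p ^ 2 - 1 / l p ^ 2) := by ring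
    rw [e4]
    linarith
  have hlocmin : IsLocalMin w p :=
    isLocalMin_of_deriv_deriv_pos hpos hlocmax.deriv_eq_zero (hd p hp01).continuousAt
  have hconst : w =ᶠ[𝓝 p] fun _ => w p := by
    filter_upwards [hlocmax, hlocmin] with s h1 h2 using le_antisymm h1 h2
  have h0 : deriv (deriv w) p = 0 := by
    have e := hconst.deriv
    rw [e.deriv_eq]
    simp
  linarith

/-- The solution of the boundary value problem is unique on `(0,1)`. -/
theorem IsProfile.unique {r l a k : ℝ → ℝ} (h : IsProfile r l a k) {t : ℝ}
    (ht : t ∈ Ioo (0 : ℝ) 1) :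
    r t = rBar t ∧ l t = lBar t ∧ a t = aBar t ∧ k t = kBar t := by
  have hb := isProfile_bar
  have hl : ∀ s ∈ Ioo (0 : ℝ) 1, l s = lBar s := fun s hs =>
    le_antisymm (h.l_le hb hs) (hb.l_le h hs)
  have hr : ∀ s ∈ Ioo (0 : ℝ) 1, r s = rBar s := fun s hs => by
    have e1 := h.mass s hs
    have e2 := hb.mass s hs
    rw [hl s hs, ← e2] at e1
    exact mul_right_cancel₀ (lBar_pos hs).ne' e1
  refine ⟨hr t ht, hl t ht, ?_, ?_⟩
  · have e1 := h.hasDerivAt_l ht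
    have e2 : HasDerivAt l (aBar t * lBar t) t := by
      refine (hb.hasDerivAt_l ht).congr_of_eventuallyEq ?_
      filter_upwards [Ioo_mem_nhds ht.1 ht.2] with s hs using hl s hs
    have e3 := e1.unique e2
    rw [hl t ht] at e3
    exact mul_right_cancel₀ (lBar_pos ht).ne' e3
  · have hd : ∀ s ∈ Ioo (0 : ℝ) 1, HasDerivAt (fun s => k s - kBar s) 0 s := fun s hs => by
      have := (h.k_ode s hs).sub (hb.k_ode s hs)
      rw [hr s hs, sub_self] at this
      exact this
    have hc : ∀ s ∈ Ioo (0 : ℝ) 1, k s - kBar s = k t - kBar t := fun s hs =>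
      isOpen_Ioo.is_const_of_deriv_eq_zero isPreconnected_Ioo
        (fun s hs => (hd s hs).differentiableAt.differentiableWithinAt)
        (fun s hs => (hd s hs).deriv) hs ht
    have h0 : Tendsto (fun s => k s - kBar s) (𝓝[>] 0) (𝓝 0) := by
      simpa using h.k_zero.sub hb.k_zero
    have h1 : Tendsto (fun s => k s - kBar s) (𝓝[>] 0) (𝓝 (k t - kBar t)) := by
      refine tendsto_const_nhds.congr' ?_
      filter_upwards [Ioo_mem_nhdsGT (zero_lt_one' ℝ)] with s hs using (hc s hs).symm
    exact sub_eq_zero.1 (tendsto_nhds_unique h1 h0)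

/-! ### The tangency time is well defined -/

theorem tendsto_dot_zero : Tendsto (fun s => aBar s * lBar s) (𝓝[>] 0) atTop := by
  have hφ : Tendsto (fun s => sin (phase s)) (𝓝[>] 0) (𝓝[>] 0) := by
    refine tendsto_nhdsWithin_iff.2 ⟨?_, ?_⟩
    · have h : Continuous fun s => sin (phase s) := Real.continuous_sin.comp phase_continuous
      have h1 := h.continuousAt (x := 0)
      rw [ContinuousAt, phase_zero, Real.sin_zero] at h1
      exact h1.mono_left nhdsWithin_le_nhds
    · have h1 := phase_continuous.continuousAt (x := 0)
      have h2 : ∀ᶠ s in 𝓝[>] (0 : ℝ), phase s < π :=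
        nhdsWithin_le_nhds (h1.eventually_lt_const (by rw [phase_zero]; exact Real.pi_pos))
      filter_upwards [h2, Ioo_mem_nhdsGT (zero_lt_one' ℝ)] with s hs hs'
      exact Real.sin_pos_of_pos_of_lt_pi (phase_mem hs').1 hs
  have hc : Tendsto (fun s => 2 * π * radius * (1 + cos (phase s))) (𝓝[>] 0)
      (𝓝 (2 * π * radius * 2)) := by
    have h : Continuous fun s => 2 * π * radius * (1 + cos (phase s)) := by
      have := phase_continuous
      fun_prop
    have h1 := h.continuousAt (x := 0)
    rw [ContinuousAt, phase_zero, Real.cos_zero] at h1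
    norm_num at h1 ⊢
    exact h1.mono_left nhdsWithin_le_nhds
  have hpos : 0 < 2 * π * radius * 2 := by
    have := radius_pos
    positivity
  have hmul := hc.pos_mul_atTop hpos (tendsto_inv_nhdsGT_zero.comp hφ)
  refine hmul.congr' ?_
  have hsin : ∀ᶠ s in 𝓝[>] (0 : ℝ), 0 < sin (phase s) :=
    (tendsto_nhdsWithin_iff.1 hφ).2
  filter_upwards [hsin, Ioo_mem_nhdsGT (zero_lt_one' ℝ)] with s hs hs'
  have hp := one_sub_cos_phase_pos hs'
  have e := Real.sin_sq_add_cos_sq (phase s)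
  unfold aBar lBar
  simp only [Function.comp_apply]
  field_simp
  linear_combination -radius * e

/-- Through each point of `ℝ × (0,1)` with `l(t) < |x|` there is exactly one tangent line of the
kind that defines `ū`. -/
theorem existsUnique_tangency {x t : ℝ} (ht : t ∈ Ioo (0 : ℝ) 1) (hx : lBar t < |x|) :
    ∃! t₀, t₀ ∈ Ioo 0 t ∧ |x| = lBar t₀ + (t - t₀) * deriv lBar t₀ := by
  set g : ℝ → ℝ := fun s => lBar s + (t - s) * (aBar s * lBar s) with hg
  have hmem : ∀ s ∈ Ioc 0 t, s ∈ Ioo (0 : ℝ) 1 := fun s hs =>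
    ⟨hs.1, lt_of_le_of_lt hs.2 ht.2⟩
  have hd : ∀ s ∈ Ioo (0 : ℝ) 1, HasDerivAt g ((t - s) * (-(3 / 2) / lBar s ^ 2)) s := by
    intro s hs
    have h1 : HasDerivAt (fun s : ℝ => t - s) (-1) s := by
      simpa using (hasDerivAt_id s).const_sub t
    refine ((hasDerivAt_lBar hs).add (h1.mul (isProfile_bar.hasDerivAt_dot hs))).congr_deriv ?_
    ring
  have hcont : ContinuousOn g (Ioc 0 t) := fun s hs =>
    (hd s (hmem s hs)).continuousAt.continuousWithinAt
  have hanti : StrictAntiOn g (Ioc 0 t) := by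
    refine strictAntiOn_of_deriv_neg (convex_Ioc 0 t) hcont fun s hs => ?_
    rw [interior_Ioc] at hs
    have hs' := hmem s ⟨hs.1, hs.2.le⟩
    rw [(hd s hs').deriv]
    have e1 := lBar_pos hs'
    have e2 : 0 < t - s := sub_pos.2 hs.2
    have e3 : -(3 / 2) / lBar s ^ 2 < 0 := div_neg_of_neg_of_pos (by norm_num) (by positivity)
    exact mul_neg_of_pos_of_neg e2 e3
  have hgt : g t = lBar t := by simp [hg]
  have hlim : Tendsto g (𝓝[>] 0) atTop := by
    have h1 : Tendsto (fun s : ℝ => t - s) (𝓝[>] 0) (𝓝 t) := by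
      have h : Continuous fun s : ℝ => t - s := by fun_prop
      have h2 := h.continuousAt (x := 0)
      rw [ContinuousAt, sub_zero] at h2
      exact h2.mono_left nhdsWithin_le_nhds
    have h2 := h1.pos_mul_atTop ht.1 tendsto_dot_zero
    refine tendsto_atTop_mono' _ ?_ h2
    filter_upwards [Ioo_mem_nhdsGT (zero_lt_one' ℝ)] with s hs
    have := lBar_pos hs
    simp only [hg]
    linarith
  obtain ⟨s₁, hs₁, hs₁'⟩ :=
    ((hlim.eventually_gt_atTop |x|).and (Ioo_mem_nhdsGT ht.1)).exists
  have hivt := intermediate_value_Ioo' hs₁'.2.le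
    (hcont.mono fun s hs => ⟨lt_of_lt_of_le hs₁'.1 hs.1, hs.2⟩)
  obtain ⟨t₀, ht₀, hgt₀⟩ := hivt ⟨by rw [hgt]; exact hx, hs₁⟩
  have hder : ∀ s ∈ Ioo 0 t, lBar s + (t - s) * deriv lBar s = g s := fun s hs => by
    rw [(hasDerivAt_lBar (hmem s ⟨hs.1, hs.2.le⟩)).deriv]
  have ht₀' : t₀ ∈ Ioo 0 t := ⟨hs₁'.1.trans ht₀.1, ht₀.2⟩
  refine ⟨t₀, ⟨ht₀', ?_⟩, ?_⟩
  · rw [hder t₀ ht₀', hgt₀]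
  · rintro s ⟨hs, hs'⟩
    rw [hder s hs] at hs'
    exact hanti.injOn ⟨hs.1, hs.2.le⟩ ⟨ht₀'.1, ht₀'.2.le⟩ (by rw [← hs', hgt₀])

theorem tangencyTime_spec {x t : ℝ} (ht : t ∈ Ioo (0 : ℝ) 1) (hx : lBar t < |x|) :
    tangencyTime x t ∈ Ioo 0 t ∧
      |x| = lBar (tangencyTime x t) + (t - tangencyTime x t) * deriv lBar (tangencyTime x t) :=
  Classical.epsilon_spec (existsUnique_tangency ht hx).exists

end Planning

namespace Planning

/-! ### Absolute continuity -/

/-! The proof is a verification argument by calibration. If `∂ₜw + (∂ₓw)²/2 ≤ ρ̄`, then by Young's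
inequality `w` grows along any path at most at the rate of the running cost, so its increments bound
the cost from below.

Two such functions are combined. `calib` is `ū` where `|x| ≤ l` and affine in `x` beyond;
`tangentSol s` is the affine solution with zero right-hand side that touches `ū` at `(l(s), s)`, and
it is admissible because `ρ̄ ≥ 0`. As `l` is strictly concave, `ū` to the right of the support is
the maximum of `tangentSol s` over `s ∈ (0,t]` (`tangentSol_le`). For an endpoint outside the
support, the path is followed backwards with the maximising `tangentSol t₀` until it meets the curve
`x = l` or time reaches `t₀`; from there `calib` takes over (`IsH1Path.exists_uBar_le`). The bound
`calib_le_add` near time zero then allows the initial time to tend to `0`.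

The bounds are attained (`exists_cost_eq_uBar`): inside by the paths `c * l`, outside by following
`l` and then a tangent line. This gives (ii), and (i) after splitting the cost at `θ`. Jensen's
inequality on an optimal path gives (iii). The straight path gives (iv), since its density cost is
at most `∫ r = k(t) → 0`. -/

theorem absolutelyContinuousOnInterval_of_hasDerivAt {f f' : ℝ → ℝ} {a b : ℝ} (hab : a ≤ b)
    (hc : ContinuousOn f (Icc a b)) (hd : ∀ x ∈ Ioo a b, HasDerivAt f (f' x) x)
    (hi : IntervalIntegrable f' volume a b) : AbsolutelyContinuousOnInterval f a b := by
  have h1 := hi.absolutelyContinuousOnInterval_intervalIntegral (c := a) left_mem_uIcc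
  have h2 : AbsolutelyContinuousOnInterval (fun _ : ℝ => f a) a b :=
    contDiffOn_const.absolutelyContinuousOnInterval
  have h3 := h1.add h2
  have h4 : ∀ x ∈ uIcc a b, f x = (∫ v in a..x, f' v) + f a := by
    intro x hx
    rw [uIcc_of_le hab] at hx
    have := intervalIntegral.integral_eq_sub_of_hasDerivAt_of_le hx.1
      (hc.mono (Icc_subset_Icc_right hx.2)) (fun z hz => hd z ⟨hz.1, hz.2.trans_le hx.2⟩)
      (hi.mono_set (by rw [uIcc_of_le hab, uIcc_of_le hx.1]; exact Icc_subset_Icc_right hx.2))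
    rw [this]
    ring
  rw [absolutelyContinuousOnInterval_iff] at h3 ⊢
  intro ε hε
  obtain ⟨δ, hδ, h⟩ := h3 ε hε
  -- The ε-δ condition evaluates the function only at points of the interval, where `f` agrees with
  -- its integral representation.
  refine ⟨δ, hδ, fun E hE hEδ => ?_⟩
  refine lt_of_eq_of_lt (Finset.sum_congr rfl fun i hi => ?_) (h E hE hEδ)
  rw [h4 _ (hE.1 i hi).1, h4 _ (hE.1 i hi).2]
  rfl

theorem _root_.AbsolutelyContinuousOnInterval.max_zero {f : ℝ → ℝ} {a b : ℝ}
    (hf : AbsolutelyContinuousOnInterval f a b) :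
    AbsolutelyContinuousOnInterval (fun x => max (f x) 0) a b := by
  refine squeeze_zero (fun E => Finset.sum_nonneg fun i _ => dist_nonneg) (fun E => ?_) hf
  refine Finset.sum_le_sum fun i _ => ?_
  exact abs_max_sub_max_le_abs _ _ _

theorem _root_.AbsolutelyContinuousOnInterval.pow_two {f : ℝ → ℝ} {a b : ℝ}
    (hf : AbsolutelyContinuousOnInterval f a b) :
    AbsolutelyContinuousOnInterval (fun x => f x ^ 2) a b := by
  simpa only [sq] using hf.fun_mul hf

/-- Squaring removes the kink of the positive part, so `calib` can be differentiated along paths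
that cross the boundary of the support. -/
theorem hasDerivAt_max_zero_sq (x : ℝ) :
    HasDerivAt (fun x : ℝ => max x 0 ^ 2) (2 * max x 0) x := by
  rcases lt_trichotomy x 0 with h | rfl | h
  · rw [max_eq_right h.le, mul_zero]
    refine (hasDerivAt_const x (0 : ℝ)).congr_of_eventuallyEq ?_
    filter_upwards [Iio_mem_nhds h] with y hy
    simp [max_eq_right (show y ≤ 0 from le_of_lt hy)]
  · have h1 : (fun x : ℝ => max x 0 ^ 2) =O[𝓝 0] fun x : ℝ => ‖x - 0‖ ^ 2 := by
      refine Asymptotics.IsBigO.of_bound 1 (Eventually.of_forall fun x => ?_)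
      simp only [sub_zero, norm_pow, norm_norm, one_mul]
      gcongr
      rw [Real.norm_eq_abs, Real.norm_eq_abs, abs_of_nonneg (le_max_right _ _)]
      exact max_le (le_abs_self x) (abs_nonneg x)
    have h2 : HasFDerivAt (fun x : ℝ => max x 0 ^ 2) (0 : ℝ →L[ℝ] ℝ) 0 := h1.hasFDerivAt one_lt_two
    simpa using h2.hasDerivAt
  · rw [max_eq_left h.le]
    have h1 : HasDerivAt (fun x : ℝ => x ^ 2) (2 * x) x := by simpa using hasDerivAt_pow 2 x
    refine h1.congr_of_eventuallyEq ?_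
    filter_upwards [Ioi_mem_nhds h] with y hy
    simp [max_eq_left (show 0 ≤ y from le_of_lt hy)]

/-! ### The profile functions -/

theorem Icc_subset_Ioo {θ t : ℝ} (hθ : 0 < θ) (ht : t < 1) : Icc θ t ⊆ Ioo (0 : ℝ) 1 :=
  fun _ hs => ⟨hθ.trans_le hs.1, hs.2.trans_lt ht⟩

theorem rBar_eq {t : ℝ} (ht : t ∈ Ioo (0 : ℝ) 1) : rBar t = 3 / 4 / lBar t := by
  rw [eq_div_iff (lBar_pos ht).ne', isProfile_bar.mass t ht]

theorem lBar_nonneg (t : ℝ) : 0 ≤ lBar t :=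
  mul_nonneg radius_pos.le (sub_nonneg.2 (Real.cos_le_one _))

theorem rBar_nonneg (t : ℝ) : 0 ≤ rBar t :=
  div_nonneg (by norm_num) (mul_nonneg (by norm_num) (lBar_nonneg t))

theorem continuousOn_rBar : ContinuousOn rBar (Ioo 0 1) := fun t ht =>
  (isProfile_bar.r_ode t ht).continuousAt.continuousWithinAt

theorem continuousOn_aBar : ContinuousOn aBar (Ioo 0 1) := fun t ht =>
  (isProfile_bar.a_ode t ht).continuousAt.continuousWithinAt

theorem deriv_lBar {t : ℝ} (ht : t ∈ Ioo (0 : ℝ) 1) : deriv lBar t = aBar t * lBar t :=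
  (hasDerivAt_lBar ht).deriv

theorem continuous_kBar : Continuous kBar := by
  unfold kBar
  have := phase_continuous
  fun_prop

theorem kBar_zero : kBar 0 = 0 := by simp [kBar, phase_zero]

theorem absolutelyContinuousOnInterval_of_hasDerivAt_Ioo {f f' : ℝ → ℝ} {θ t : ℝ}
    (hθ : 0 < θ) (hθt : θ ≤ t) (ht : t < 1) (hd : ∀ s ∈ Ioo (0 : ℝ) 1, HasDerivAt f (f' s) s)
    (hc : ContinuousOn f' (Ioo 0 1)) : AbsolutelyContinuousOnInterval f θ t := by
  have hsub := Icc_subset_Ioo hθ ht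
  refine absolutelyContinuousOnInterval_of_hasDerivAt hθt
    (fun s hs => (hd s (hsub hs)).continuousAt.continuousWithinAt)
    (fun s hs => hd s (hsub (Ioo_subset_Icc_self hs))) ?_
  refine ContinuousOn.intervalIntegrable ?_
  rw [uIcc_of_le hθt]
  exact hc.mono hsub

/-- Although `r` blows up at both ends, it is the nonnegative derivative of `k`, which is continuous
on `[0,1]`. -/
theorem integrableOn_rBar : IntegrableOn rBar (Ioc 0 1) :=
  intervalIntegral.integrableOn_deriv_of_nonneg continuous_kBar.continuousOn
    isProfile_bar.k_ode fun t _ => rBar_nonneg t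

theorem integral_rBar {t : ℝ} (h0 : 0 ≤ t) (ht : t ≤ 1) : ∫ s in (0 : ℝ)..t, rBar s = kBar t := by
  rw [intervalIntegral.integral_eq_sub_of_hasDerivAt_of_le h0 continuous_kBar.continuousOn
    (fun s hs => isProfile_bar.k_ode s ⟨hs.1, hs.2.trans_le ht⟩), kBar_zero, sub_zero]
  rw [intervalIntegrable_iff, uIoc_of_le h0]
  exact integrableOn_rBar.mono_set (Ioc_subset_Ioc_right ht)

/-! ### The cost of a path -/

theorem rhoBar_nonneg (x t : ℝ) : 0 ≤ rhoBar x t :=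
  mul_nonneg (rBar_nonneg t) (le_max_right _ _)

theorem rhoBar_le (x t : ℝ) : rhoBar x t ≤ rBar t := by
  refine mul_le_of_le_one_right (rBar_nonneg t) (max_le ?_ zero_le_one)
  linarith [sq_nonneg (x / lBar t)]

theorem rhoBar_neg (x t : ℝ) : rhoBar (-x) t = rhoBar x t := by
  simp [rhoBar, neg_div]

theorem IsH1Path.continuousOn {y : ℝ → ℝ} (hy : IsH1Path y) : ContinuousOn y (Icc 0 1) := by
  simpa [uIcc_of_le] using hy.1.continuousOn

theorem IsH1Path.mono {y : ℝ → ℝ} (hy : IsH1Path y) {θ t : ℝ} (hθ : 0 ≤ θ) (hθt : θ ≤ t)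
    (ht : t ≤ 1) : AbsolutelyContinuousOnInterval y θ t := by
  refine hy.1.mono ?_
  rw [uIcc_of_le hθt, uIcc_of_le zero_le_one]
  exact Icc_subset_Icc hθ ht

theorem IsH1Path.integrableOn_deriv_sq {y : ℝ → ℝ} (hy : IsH1Path y) :
    IntegrableOn (fun s => deriv y s ^ 2) (Ioc 0 1) := by
  rw [integrableOn_Ioc_iff_integrableOn_Ioo]
  exact hy.2.integrable_sq

theorem integrableOn_rhoBar {y : ℝ → ℝ} (hy : ContinuousOn y (Ioo 0 1)) :
    IntegrableOn (fun s => rhoBar (y s) s) (Ioc 0 1) := by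
  rw [integrableOn_Ioc_iff_integrableOn_Ioo]
  refine Integrable.mono' (integrableOn_rBar.mono_set Ioo_subset_Ioc_self) ?_
    (Eventually.of_forall fun s => ?_)
  · refine ContinuousOn.aestronglyMeasurable ?_ measurableSet_Ioo
    refine continuousOn_rBar.mul (ContinuousOn.sup ?_ continuousOn_const)
    exact continuousOn_const.sub ((hy.div lBar_continuous.continuousOn
      fun s hs => (lBar_pos hs).ne').pow 2)
  · rw [Real.norm_of_nonneg (rhoBar_nonneg _ _)]
    exact rhoBar_le _ _

theorem intervalIntegrable_of_integrableOn {f : ℝ → ℝ} (hf : IntegrableOn f (Ioc 0 1)) {θ t : ℝ}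
    (hθ : 0 ≤ θ) (hθt : θ ≤ t) (ht : t ≤ 1) : IntervalIntegrable f volume θ t := by
  rw [intervalIntegrable_iff, uIoc_of_le hθt]
  exact hf.mono_set (Ioc_subset_Ioc hθ ht)

theorem IsH1Path.integrableOn_cost {y : ℝ → ℝ} (hy : IsH1Path y) :
    IntegrableOn (fun s => deriv y s ^ 2 / 2 + rhoBar (y s) s) (Ioc 0 1) :=
  (hy.integrableOn_deriv_sq.div_const 2).add
    (integrableOn_rhoBar (hy.continuousOn.mono Ioo_subset_Icc_self))

theorem IsH1Path.cost_add {y : ℝ → ℝ} (hy : IsH1Path y) {a b c : ℝ} (ha : 0 ≤ a) (hab : a ≤ b)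
    (hbc : b ≤ c) (hc : c ≤ 1) : cost y a b + cost y b c = cost y a c :=
  intervalIntegral.integral_add_adjacent_intervals
    (intervalIntegrable_of_integrableOn hy.integrableOn_cost ha hab (hbc.trans hc))
    (intervalIntegrable_of_integrableOn hy.integrableOn_cost (ha.trans hab) hbc hc)

theorem IsH1Path.integral_deriv {y : ℝ → ℝ} (hy : IsH1Path y) {a b : ℝ} (ha : 0 ≤ a) (hab : a ≤ b)
    (hb : b ≤ 1) : ∫ s in a..b, deriv y s = y b - y a :=
  (hy.mono ha hab hb).integral_deriv_eq_sub

/-- The affine functions `x ↦ c x - c² t / 2` calibrate the kinetic energy. -/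
theorem IsH1Path.affine_le_integral {y : ℝ → ℝ} (hy : IsH1Path y) (c : ℝ) {a b : ℝ} (ha : 0 ≤ a)
    (hab : a ≤ b) (hb : b ≤ 1) :
    c * (y b - y a) - c ^ 2 / 2 * (b - a) ≤ ∫ s in a..b, deriv y s ^ 2 / 2 := by
  have h1 := (hy.mono ha hab hb).intervalIntegrable_deriv
  have h2 : ∫ s in a..b, (c * deriv y s - c ^ 2 / 2) = c * (y b - y a) - c ^ 2 / 2 * (b - a) := by
    rw [intervalIntegral.integral_sub (h1.const_mul c) intervalIntegrable_const,
      intervalIntegral.integral_const_mul, hy.integral_deriv ha hab hb,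
      intervalIntegral.integral_const]
    simp [mul_comm]
  rw [← h2]
  refine intervalIntegral.integral_mono_on hab ((h1.const_mul c).sub intervalIntegrable_const)
    ((intervalIntegrable_of_integrableOn hy.integrableOn_deriv_sq ha hab hb).div_const 2)
    fun s _ => ?_
  nlinarith [sq_nonneg (deriv y s - c)]

theorem IsH1Path.integral_le_cost {y : ℝ → ℝ} (hy : IsH1Path y) {a b : ℝ} (ha : 0 ≤ a)
    (hab : a ≤ b) (hb : b ≤ 1) : ∫ s in a..b, deriv y s ^ 2 / 2 ≤ cost y a b :=
  intervalIntegral.integral_mono_on hab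
    ((intervalIntegrable_of_integrableOn hy.integrableOn_deriv_sq ha hab hb).div_const 2)
    (intervalIntegrable_of_integrableOn hy.integrableOn_cost ha hab hb)
    fun _ _ => le_add_of_nonneg_right (rhoBar_nonneg _ _)

theorem IsH1Path.sq_div_le_integral {y : ℝ → ℝ} (hy : IsH1Path y) (h0 : y 0 = 0) {t : ℝ}
    (ht0 : 0 < t) (ht : t ≤ 1) : y t ^ 2 / (2 * t) ≤ ∫ s in (0 : ℝ)..t, deriv y s ^ 2 / 2 := by
  -- The slope `y t / t` maximises `c * y t - c ^ 2 * t / 2` over `c`.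
  refine le_of_eq_of_le ?_ (hy.affine_le_integral (y t / t) le_rfl ht0.le ht)
  rw [h0]
  field_simp
  ring

theorem deriv_fun_neg' (y : ℝ → ℝ) : deriv (fun s => -y s) = fun s => -deriv y s := by
  ext s
  exact deriv.fun_neg

theorem IsH1Path.neg {y : ℝ → ℝ} (hy : IsH1Path y) : IsH1Path fun s => -y s := by
  refine ⟨hy.1.neg, ?_⟩
  rw [deriv_fun_neg']
  exact hy.2.neg

theorem cost_neg (y : ℝ → ℝ) (a b : ℝ) : cost (fun s => -y s) a b = cost y a b := by
  unfold cost
  rw [deriv_fun_neg']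
  simp [rhoBar_neg]

theorem uBar_neg (x t : ℝ) : uBar (-x) t = uBar x t := by
  unfold uBar tangencyTime uInner
  simp

/-! ### The calibration -/

/-- The subsolution which agrees with `ū` in `{|z| ≤ l(s)}` and continues it affinely in space. -/
noncomputable def calib (z s : ℝ) : ℝ :=
  kBar s + aBar s / 2 * (z ^ 2 - max (z - lBar s) 0 ^ 2 - max (-z - lBar s) 0 ^ 2)

theorem calib_neg (z s : ℝ) : calib (-z) s = calib z s := by
  unfold calib
  rw [neg_neg]
  ring

theorem calib_eq_uInner {z s : ℝ} (h : |z| ≤ lBar s) : calib z s = uInner z s := by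
  have h1 := abs_le.1 h
  unfold calib uInner
  rw [max_eq_right (by linarith), max_eq_right (by linarith)]
  ring

theorem calib_eq_of_le {z s : ℝ} (h : lBar s ≤ z) :
    calib z s = uInner (lBar s) s + aBar s * lBar s * (z - lBar s) := by
  have h1 := lBar_nonneg s
  unfold calib uInner
  rw [max_eq_left (by linarith), max_eq_right (by linarith)]
  ring

/-- Staying away from the times `0` and `1` keeps the coefficients smooth; what remains are sums,
products and positive parts of absolutely continuous functions. -/
theorem absolutelyContinuousOnInterval_calib {y : ℝ → ℝ} {θ t : ℝ} (hθ : 0 < θ) (hθt : θ ≤ t)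
    (ht : t < 1) (hy : AbsolutelyContinuousOnInterval y θ t) :
    AbsolutelyContinuousOnInterval (fun s => calib (y s) s) θ t := by
  have hk := absolutelyContinuousOnInterval_of_hasDerivAt_Ioo hθ hθt ht isProfile_bar.k_ode
    continuousOn_rBar
  have ha := absolutelyContinuousOnInterval_of_hasDerivAt_Ioo hθ hθt ht isProfile_bar.a_ode
    ((continuousOn_aBar.pow 2).add (continuousOn_const.mul (continuousOn_rBar.pow 3))).neg
  have hl := absolutelyContinuousOnInterval_of_hasDerivAt_Ioo hθ hθt ht
    (fun _ hs => hasDerivAt_lBar hs) (continuousOn_aBar.mul lBar_continuous.continuousOn)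
  have h := hk.fun_add (((ha.const_mul (1 / 2)).fun_mul
    ((hy.pow_two.fun_sub (hy.fun_sub hl).max_zero.pow_two).fun_sub
      (hy.fun_neg.fun_sub hl).max_zero.pow_two)))
  refine (congrArg (AbsolutelyContinuousOnInterval · θ t) (funext fun s => ?_)).mpr h
  unfold calib
  ring

/-- The derivative of the calibration along a path is at most the running cost. -/
theorem exists_hasDerivAt_calib {y : ℝ → ℝ} {v s : ℝ} (hs : s ∈ Ioo (0 : ℝ) 1)
    (hy : HasDerivAt y v s) :
    ∃ d, HasDerivAt (fun s => calib (y s) s) d s ∧ d ≤ v ^ 2 / 2 + rhoBar (y s) s := by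
  have hl0 := lBar_pos hs
  have hr := rBar_eq hs
  have hk := isProfile_bar.k_ode s hs
  have ha := isProfile_bar.a_ode s hs
  have hl := hasDerivAt_lBar hs
  have h1 : HasDerivAt (fun s => max (y s - lBar s) 0 ^ 2)
      (2 * max (y s - lBar s) 0 * (v - aBar s * lBar s)) s :=
    (hasDerivAt_max_zero_sq _).comp s (hy.sub hl)
  have h2 : HasDerivAt (fun s => max (-y s - lBar s) 0 ^ 2)
      (2 * max (-y s - lBar s) 0 * (-v - aBar s * lBar s)) s :=
    (hasDerivAt_max_zero_sq _).comp s (hy.neg.sub hl)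
  refine ⟨_, hk.add ((ha.div_const 2).mul (((hy.pow 2).sub h1).sub h2)), ?_⟩
  unfold rhoBar
  -- With `r = 3 / (4 l)`, everything is expressed through `a`, `l` and the position.
  have hr3 : 32 / 9 * rBar s ^ 3 = 3 / 2 / lBar s ^ 3 := by
    rw [hr]; field_simp; norm_num
  rw [hr3, hr]
  generalize aBar s = a at *
  generalize y s = z at *
  generalize lBar s = l at *
  rcases le_or_gt |z| l with hz | hz
  · have hz' := abs_le.1 hz
    have e : (z / l) ^ 2 ≤ 1 := by
      rw [div_pow, div_le_one (by positivity)]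
      exact sq_le_sq' hz'.1 hz'.2
    rw [max_eq_right (by linarith : z - l ≤ 0), max_eq_right (by linarith : -z - l ≤ 0),
      max_eq_left (by linarith)]
    -- Inside the support the Hamilton-Jacobi equation holds exactly, so the only loss is the square
    -- `(v - a z)² / 2`.
    have e2 : 3 / 4 / l * (1 - (z / l) ^ 2) = 3 / 4 / l - 3 / 2 / l ^ 3 * z ^ 2 / 2 := by
      field_simp
      ring
    rw [e2]
    norm_num
    nlinarith [sq_nonneg (v - a * z)]
  · have e : 1 ≤ (z / l) ^ 2 := by
      rw [div_pow, one_le_div (by positivity), ← sq_abs z]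
      gcongr
    rw [max_eq_right (by linarith : 1 - (z / l) ^ 2 ≤ 0)]
    rcases lt_abs.1 hz with h | h
    · rw [max_eq_left (by linarith : 0 ≤ z - l), max_eq_right (by linarith : -z - l ≤ 0)]
      -- This expression is `∂ₛw + (∂_z w)²/2` for `w = calib` at `z > l`; it equals `l'' * (z - l)`
      -- with `l'' = -(3/2) / l²`.
      have e3 : 3 / 4 / l - 3 / 2 / l ^ 3 / 2 * (2 * l * z - l ^ 2) ≤ 0 := by
        have : 3 / 4 / l - 3 / 2 / l ^ 3 / 2 * (2 * l * z - l ^ 2) = 3 / 2 / l ^ 2 * (l - z) := by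
          field_simp
          ring
        rw [this]
        exact mul_nonpos_of_nonneg_of_nonpos (by positivity) (by linarith)
      norm_num
      nlinarith [sq_nonneg (v - a * l)]
    · rw [max_eq_right (by linarith : z - l ≤ 0), max_eq_left (by linarith : 0 ≤ -z - l)]
      have e3 : 3 / 4 / l - 3 / 2 / l ^ 3 / 2 * (2 * l * -z - l ^ 2) ≤ 0 := by
        have : 3 / 4 / l - 3 / 2 / l ^ 3 / 2 * (2 * l * -z - l ^ 2) = 3 / 2 / l ^ 2 * (l + z) := by
          field_simp
          ring
        rw [this]
        exact mul_nonpos_of_nonneg_of_nonpos (by positivity) (by linarith)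
      norm_num
      nlinarith [sq_nonneg (v + a * l)]

theorem IsH1Path.calib_le {y : ℝ → ℝ} (hy : IsH1Path y) {θ t : ℝ} (hθ : 0 < θ) (hθt : θ ≤ t)
    (ht : t < 1) : calib (y t) t ≤ calib (y θ) θ + cost y θ t := by
  have hac := hy.mono hθ.le hθt ht.le
  have hc := absolutelyContinuousOnInterval_calib hθ hθt ht hac
  have h1 : ∫ s in θ..t, deriv (fun s => calib (y s) s) s ≤ cost y θ t := by
    refine intervalIntegral.integral_mono_ae_restrict hθt hc.intervalIntegrable_deriv
      (intervalIntegrable_of_integrableOn hy.integrableOn_cost hθ.le hθt ht.le) ?_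
    filter_upwards [ae_restrict_of_ae hac.ae_differentiableAt,
      ae_restrict_mem measurableSet_Icc] with s hs hs'
    have hd := (hs (by rwa [uIcc_of_le hθt])).hasDerivAt
    obtain ⟨d, hd, hle⟩ := exists_hasDerivAt_calib (Icc_subset_Ioo hθ ht hs') hd
    rw [hd.deriv]
    exact hle
  rw [hc.integral_deriv_eq_sub] at h1
  linarith

/-! ### The tangent solutions -/

/-- The affine solution of the Hamilton-Jacobi equation without right-hand side that agrees with
`ū` to first order at the point `(l(s), s)`. -/
noncomputable def tangentSol (s x t : ℝ) : ℝ :=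
  uInner (lBar s) s + aBar s * lBar s * (x - lBar s) - (aBar s * lBar s) ^ 2 / 2 * (t - s)

/-- The boundary curve is a characteristic, with velocity `l' = a l = ∂ₓū`, and the density vanishes
on it; so `ū` grows along it at the rate of the kinetic energy. -/
theorem hasDerivAt_uInner_lBar {s : ℝ} (hs : s ∈ Ioo (0 : ℝ) 1) :
    HasDerivAt (fun s => uInner (lBar s) s) ((aBar s * lBar s) ^ 2 / 2) s := by
  have hl := lBar_pos hs
  have h := (isProfile_bar.k_ode s hs).add
    (((isProfile_bar.a_ode s hs).mul ((hasDerivAt_lBar hs).pow 2)).div_const 2)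
  refine h.congr_deriv ?_
  rw [rBar_eq hs]
  field_simp
  norm_num
  ring

/-- Strict concavity of `l`: its second derivative is `-(3/2) / l²`. -/
theorem strictAntiOn_slope : StrictAntiOn (fun s => aBar s * lBar s) (Ioo 0 1) := by
  refine strictAntiOn_of_deriv_neg (convex_Ioo 0 1)
    (continuousOn_aBar.mul lBar_continuous.continuousOn) fun s hs => ?_
  rw [interior_Ioo] at hs
  rw [(isProfile_bar.hasDerivAt_dot hs).deriv]
  have := lBar_pos hs
  exact div_neg_of_neg_of_pos (by norm_num) (by positivity)

theorem hasDerivAt_tangentLine (t : ℝ) {s : ℝ} (hs : s ∈ Ioo (0 : ℝ) 1) :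
    HasDerivAt (fun s => lBar s + (t - s) * (aBar s * lBar s))
      ((t - s) * (-(3 / 2) / lBar s ^ 2)) s := by
  have h1 : HasDerivAt (fun s : ℝ => t - s) (-1) s := (hasDerivAt_id s).const_sub t
  refine ((hasDerivAt_lBar hs).add (h1.mul (isProfile_bar.hasDerivAt_dot hs))).congr_deriv ?_
  ring

/-- The derivative in the tangency time is `(t - s) * l''(s) ≤ 0`. -/
theorem antitoneOn_tangentLine {t : ℝ} (ht : t < 1) :
    AntitoneOn (fun s => lBar s + (t - s) * (aBar s * lBar s)) (Ioc 0 t) := by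
  have hmem : ∀ s ∈ Ioc 0 t, s ∈ Ioo (0 : ℝ) 1 := fun s hs => ⟨hs.1, hs.2.trans_lt ht⟩
  refine antitoneOn_of_deriv_nonpos (convex_Ioc 0 t)
    (fun s hs => (hasDerivAt_tangentLine t (hmem s hs)).continuousAt.continuousWithinAt)
    (fun s hs => (hasDerivAt_tangentLine t
      (hmem s (interior_subset hs))).differentiableAt.differentiableWithinAt) fun s hs => ?_
  have hs' := interior_subset hs
  rw [(hasDerivAt_tangentLine t (hmem s hs')).deriv]
  exact mul_nonpos_of_nonneg_of_nonpos (sub_nonneg.2 hs'.2)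
    (div_nonpos_of_nonpos_of_nonneg (by norm_num) (by positivity))

theorem lBar_le_tangentLine {s t : ℝ} (hs : 0 < s) (hst : s ≤ t) (ht : t < 1) :
    lBar t ≤ lBar s + (t - s) * (aBar s * lBar s) := by
  simpa using antitoneOn_tangentLine ht ⟨hs, hst⟩ ⟨hs.trans_le hst, le_rfl⟩ hst

/-- An envelope computation: the terms without `l''` cancel, so the derivative vanishes exactly when
`x` lies on the tangent line at `s`. -/
theorem hasDerivAt_tangentSol (x t : ℝ) {s : ℝ} (hs : s ∈ Ioo (0 : ℝ) 1) :
    HasDerivAt (fun s => tangentSol s x t)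
      (-(3 / 2) / lBar s ^ 2 * (x - (lBar s + (t - s) * (aBar s * lBar s)))) s := by
  have hd := isProfile_bar.hasDerivAt_dot hs
  have h1 : HasDerivAt (fun s : ℝ => t - s) (-1) s := (hasDerivAt_id s).const_sub t
  have h := ((hasDerivAt_uInner_lBar hs).add (hd.mul ((hasDerivAt_lBar hs).const_sub x))).sub
    (((hd.pow 2).div_const 2).mul h1)
  refine h.congr_deriv ?_
  norm_num
  ring

/-- Among the tangent solutions, the value at `(x,t)` is largest for the one whose tangent line
passes through `(x,t)`. -/
theorem tangentSol_le {t t₀ s x : ℝ} (ht : t < 1) (ht₀ : t₀ ∈ Ioc 0 t)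
    (hx : x = lBar t₀ + (t - t₀) * (aBar t₀ * lBar t₀)) (hs : s ∈ Ioc 0 t) :
    tangentSol s x t ≤ tangentSol t₀ x t := by
  have hmem : ∀ s ∈ Ioc 0 t, s ∈ Ioo (0 : ℝ) 1 := fun s hs => ⟨hs.1, hs.2.trans_lt ht⟩
  have hneg : ∀ s, -(3 / 2) / lBar s ^ 2 ≤ 0 := fun s =>
    div_nonpos_of_nonpos_of_nonneg (by norm_num) (by positivity)
  rcases le_total s t₀ with h | h
  · have hsub : ∀ u ∈ Icc s t₀, u ∈ Ioc 0 t := fun u hu => ⟨hs.1.trans_le hu.1, hu.2.trans ht₀.2⟩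
    refine monotoneOn_of_deriv_nonneg (convex_Icc s t₀)
      (fun u hu => (hasDerivAt_tangentSol x t (hmem u (hsub u hu))).continuousAt.continuousWithinAt)
      (fun u hu => (hasDerivAt_tangentSol x t (hmem u
        (hsub u (interior_subset hu)))).differentiableAt.differentiableWithinAt)
      (fun u hu => ?_) (left_mem_Icc.2 h) (right_mem_Icc.2 h) h
    have hu' := interior_subset hu
    rw [(hasDerivAt_tangentSol x t (hmem u (hsub u hu'))).deriv]
    have := antitoneOn_tangentLine ht (hsub u hu') ht₀ hu'.2
    exact mul_nonneg_of_nonpos_of_nonpos (hneg u) (by rw [hx]; exact sub_nonpos.2 this)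
  · have hsub : ∀ u ∈ Icc t₀ s, u ∈ Ioc 0 t := fun u hu => ⟨ht₀.1.trans_le hu.1, hu.2.trans hs.2⟩
    refine antitoneOn_of_deriv_nonpos (convex_Icc t₀ s)
      (fun u hu => (hasDerivAt_tangentSol x t (hmem u (hsub u hu))).continuousAt.continuousWithinAt)
      (fun u hu => (hasDerivAt_tangentSol x t (hmem u
        (hsub u (interior_subset hu)))).differentiableAt.differentiableWithinAt)
      (fun u hu => ?_) (left_mem_Icc.2 h) (right_mem_Icc.2 h) h
    have hu' := interior_subset hu
    rw [(hasDerivAt_tangentSol x t (hmem u (hsub u hu'))).deriv]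
    have := antitoneOn_tangentLine ht ht₀ (hsub u hu') hu'.1
    exact mul_nonpos_of_nonpos_of_nonneg (hneg u) (by rw [hx]; exact sub_nonneg.2 this)

theorem uBar_eq_uInner {x t : ℝ} (h : |x| ≤ lBar t) : uBar x t = uInner x t := if_pos h

/-- Outside of the support of the density, `ū` is given by a tangent solution. -/
theorem exists_uBar_eq_tangentSol {x t : ℝ} (ht : t ∈ Ioo (0 : ℝ) 1) (hx : lBar t ≤ x) :
    ∃ t₀ ∈ Ioc 0 t, x = lBar t₀ + (t - t₀) * (aBar t₀ * lBar t₀) ∧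
      uBar x t = tangentSol t₀ x t := by
  have hx0 : 0 ≤ x := (lBar_nonneg t).trans hx
  rcases hx.eq_or_lt with h | h
  -- On the boundary of the support the tangency time degenerates to `t`; hence the half-open
  -- interval for `t₀`.
  · refine ⟨t, ⟨ht.1, le_rfl⟩, by simp [h], ?_⟩
    rw [uBar_eq_uInner (by rw [abs_of_nonneg hx0, h]), ← h]
    simp [tangentSol]
  · have hs := tangencyTime_spec ht (by rwa [abs_of_nonneg hx0])
    rw [abs_of_nonneg hx0] at hs
    have hu : uBar x t = uInner (lBar (tangencyTime x t)) (tangencyTime x t)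
        + deriv lBar (tangencyTime x t) ^ 2 / 2 * (t - tangencyTime x t) :=
      if_neg (by rw [abs_of_nonneg hx0]; exact not_le.2 h)
    rw [hu]
    generalize tangencyTime x t = t₀ at *
    rw [deriv_lBar ⟨hs.1.1, hs.1.2.trans ht.2⟩] at *
    refine ⟨t₀, ⟨hs.1.1, hs.1.2.le⟩, hs.2, ?_⟩
    unfold tangentSol
    linear_combination -(aBar t₀ * lBar t₀) * hs.2

theorem tangentSol_le_uBar {s x t : ℝ} (ht : t < 1) (hx : lBar t ≤ x) (hs : s ∈ Ioc 0 t) :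
    tangentSol s x t ≤ uBar x t := by
  obtain ⟨t₀, ht₀, hxt₀, hu⟩ := exists_uBar_eq_tangentSol ⟨hs.1.trans_le hs.2, ht⟩ hx
  rw [hu]
  exact tangentSol_le ht ht₀ hxt₀ hs

theorem calib_eq_tangentSol {x t : ℝ} (h : lBar t ≤ x) : calib x t = tangentSol t x t := by
  rw [calib_eq_of_le h]
  simp [tangentSol]

/-- To the right of the support, `calib` is the tangent solution with `s = t`, one competitor in the
maximum that defines `ū`. -/
theorem calib_le_uBar {x t : ℝ} (ht : t ∈ Ioo (0 : ℝ) 1) : calib x t ≤ uBar x t := by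
  wlog hx : 0 ≤ x generalizing x
  · rw [← calib_neg, ← uBar_neg]
    exact this (by linarith)
  rcases le_total x (lBar t) with h | h
  · rw [← abs_of_nonneg hx] at h
    rw [calib_eq_uInner h, uBar_eq_uInner h]
  · rw [calib_eq_tangentSol h]
    exact tangentSol_le_uBar ht.2 h ⟨ht.1, le_rfl⟩

theorem IsH1Path.tangentSol_le {y : ℝ → ℝ} (hy : IsH1Path y) (s : ℝ) {τ t : ℝ} (hτ : 0 ≤ τ)
    (hτt : τ ≤ t) (ht : t ≤ 1) : tangentSol s (y t) t ≤ tangentSol s (y τ) τ + cost y τ t := by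
  have h := (hy.affine_le_integral (aBar s * lBar s) hτ hτt ht).trans (hy.integral_le_cost hτ hτt ht)
  unfold tangentSol
  linarith

/-! ### The lower bound for the cost -/

/-- The first bound is the dynamic programming inequality. The stronger one with `calib`, for early
`θ`, serves the limit `θ → 0`, because `calib` has an explicit upper bound near time zero. -/
theorem IsH1Path.exists_uBar_le {y : ℝ → ℝ} (hy : IsH1Path y) {t : ℝ} (ht : t ∈ Ioo (0 : ℝ) 1) :
    ∃ t₀ ∈ Ioc 0 t, ∀ θ ∈ Ioc 0 t, uBar (y t) t ≤ uBar (y θ) θ + cost y θ t ∧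
      (θ ≤ t₀ → uBar (y t) t ≤ calib (y θ) θ + cost y θ t) := by
  wlog hx : 0 ≤ y t generalizing y
  · have h := this hy.neg (by linarith)
    simpa only [uBar_neg, calib_neg, cost_neg] using h
  -- Once a bound by `calib` holds at some time, the calibration carries it back to all earlier
  -- times.
  have key : ∀ τ θ, θ ∈ Ioc 0 t → θ ≤ τ → τ ≤ t → uBar (y t) t ≤ calib (y τ) τ + cost y τ t →
      uBar (y t) t ≤ calib (y θ) θ + cost y θ t := fun τ θ hθ h1 h2 h3 => by
    have h4 := hy.calib_le hθ.1 h1 (h2.trans_lt ht.2)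
    have h5 := hy.cost_add hθ.1.le h1 h2 ht.2.le
    linarith
  have key' : ∀ θ, θ ∈ Ioc 0 t → uBar (y t) t ≤ calib (y θ) θ + cost y θ t →
      uBar (y t) t ≤ uBar (y θ) θ + cost y θ t := fun θ hθ h =>
    h.trans (by gcongr; exact calib_le_uBar ⟨hθ.1, hθ.2.trans_lt ht.2⟩)
  rcases le_total (y t) (lBar t) with h | h
  · refine ⟨t, ⟨ht.1, le_rfl⟩, fun θ hθ => ?_⟩
    have h1 : uBar (y t) t ≤ calib (y θ) θ + cost y θ t := by
      refine key t θ hθ hθ.2 le_rfl ?_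
      rw [← abs_of_nonneg hx] at h
      rw [calib_eq_uInner h, uBar_eq_uInner h]
      simp [cost]
    exact ⟨key' θ hθ h1, fun _ => h1⟩
  · obtain ⟨t₀, ht₀, -, hu⟩ := exists_uBar_eq_tangentSol ht h
    -- A path at or left of the curve at time `m ≥ t₀` meets it at some `τ ∈ [m, t]`. There
    -- `tangentSol t₀` is at most `ū`, which equals `calib`, so the calibrations can be exchanged.
    have step : ∀ m ∈ Icc t₀ t, y m ≤ lBar m → ∃ τ ∈ Icc m t,
        uBar (y t) t ≤ calib (y τ) τ + cost y τ t := by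
      intro m hm hym
      have hm0 : 0 < m := ht₀.1.trans_le hm.1
      have hc : ContinuousOn (fun s => y s - lBar s) (Icc m t) :=
        (hy.continuousOn.mono (Icc_subset_Icc hm0.le ht.2.le)).sub lBar_continuous.continuousOn
      obtain ⟨τ, hτ, hτ0⟩ := intermediate_value_Icc hm.2 hc
        (show (0 : ℝ) ∈ Icc _ _ from ⟨sub_nonpos.2 hym, sub_nonneg.2 h⟩)
      have hτ0 : y τ = lBar τ := sub_eq_zero.1 hτ0
      refine ⟨τ, hτ, ?_⟩
      rw [hu]
      refine (hy.tangentSol_le t₀ (hm0.le.trans hτ.1) hτ.2 ht.2.le).trans ?_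
      gcongr
      have h1 := tangentSol_le_uBar (hτ.2.trans_lt ht.2) hτ0.ge ⟨ht₀.1, hm.1.trans hτ.1⟩
      rw [hτ0] at h1 ⊢
      have h2 : |lBar τ| ≤ lBar τ := (abs_of_nonneg (lBar_nonneg τ)).le
      rwa [calib_eq_uInner h2, ← uBar_eq_uInner h2]
    refine ⟨t₀, ht₀, fun θ hθ => ?_⟩
    have h1 : θ ≤ t₀ → uBar (y t) t ≤ calib (y θ) θ + cost y θ t := by
      intro hθt₀
      rcases le_total (y t₀) (lBar t₀) with h2 | h2
      · obtain ⟨τ, hτ, h3⟩ := step t₀ ⟨le_rfl, ht₀.2⟩ h2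
        exact key τ θ hθ (hθt₀.trans hτ.1) hτ.2 h3
      -- To the right of the curve at time `t₀` the two calibrations coincide.
      · refine key t₀ θ hθ hθt₀ ht₀.2 ?_
        rw [calib_eq_tangentSol h2, hu]
        exact hy.tangentSol_le t₀ ht₀.1.le ht₀.2 ht.2.le
    refine ⟨?_, h1⟩
    rcases le_total θ t₀ with hθt₀ | hθt₀
    · exact key' θ hθ (h1 hθt₀)
    rcases le_total (y θ) (lBar θ) with h2 | h2
    · obtain ⟨τ, hτ, h3⟩ := step θ ⟨hθt₀, hθ.2⟩ h2
      exact key' θ hθ (key τ θ hθ hτ.1 hτ.2 h3)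
    · rw [hu]
      refine (hy.tangentSol_le t₀ hθ.1.le hθ.2 ht.2.le).trans ?_
      gcongr
      exact tangentSol_le_uBar (hθ.2.trans_lt ht.2) h2 ⟨ht₀.1, hθt₀⟩

/-! ### Letting the initial time tend to zero -/

/-- By concavity and `l ≥ 0`, the slope of a chord of `l` ending at `t` exceeds `l'(t) = a l`; the
left end of the chord then tends to `0`. -/
theorem aBar_mul_le_one {t : ℝ} (ht : t ∈ Ioo (0 : ℝ) 1) : aBar t * t ≤ 1 := by
  have hl := lBar_pos ht
  have h : ∀ s ∈ Ioo 0 t, t * (aBar t * lBar t) ≤ lBar t + s * (aBar t * lBar t) := by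
    intro s hs
    have hs1 : s ∈ Ioo (0 : ℝ) 1 := ⟨hs.1, hs.2.trans ht.2⟩
    obtain ⟨c, hc, hceq⟩ := exists_hasDerivAt_eq_slope lBar (fun u => aBar u * lBar u) hs.2
      lBar_continuous.continuousOn (fun u hu => hasDerivAt_lBar ⟨hs.1.trans hu.1, hu.2.trans ht.2⟩)
    have h1 := strictAntiOn_slope ⟨hs.1.trans hc.1, hc.2.trans ht.2⟩ ht hc.2
    simp only at h1
    rw [hceq, lt_div_iff₀ (sub_pos.2 hs.2)] at h1
    linarith [lBar_nonneg s]
  have h2 : Tendsto (fun s => lBar t + s * (aBar t * lBar t)) (𝓝[>] 0)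
      (𝓝 (lBar t + 0 * (aBar t * lBar t))) :=
    (Continuous.tendsto (by fun_prop) 0).mono_left nhdsWithin_le_nhds
  have h3 := ge_of_tendsto h2 (by filter_upwards [Ioo_mem_nhdsGT ht.1] with s hs using h s hs)
  refine le_of_mul_le_mul_right ?_ hl
  linarith

theorem calib_le_add {z t : ℝ} (ht : t ∈ Ioo (0 : ℝ) 1) (ha : 0 ≤ aBar t) :
    calib z t ≤ kBar t + z ^ 2 / (2 * t) := by
  have h1 := aBar_mul_le_one ht
  have h2 : aBar t ≤ 1 / t := (le_div_iff₀ ht.1).2 h1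
  unfold calib
  have h3 : aBar t / 2 * (z ^ 2 - max (z - lBar t) 0 ^ 2 - max (-z - lBar t) 0 ^ 2)
      ≤ 1 / t / 2 * z ^ 2 := by
    refine (mul_le_mul_of_nonneg_left (b := _) (c := z ^ 2) ?_ (by positivity)).trans ?_
    · linarith [sq_nonneg (max (z - lBar t) 0), sq_nonneg (max (-z - lBar t) 0)]
    · gcongr
  refine (add_le_add_right h3 _).trans_eq ?_
  field_simp

theorem eventually_aBar_pos : ∀ᶠ t in 𝓝[>] (0 : ℝ), 0 ≤ aBar t := by
  filter_upwards [tendsto_dot_zero.eventually_ge_atTop 0, Ioo_mem_nhdsGT (zero_lt_one' ℝ)]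
    with s hs hs'
  exact nonneg_of_mul_nonneg_left hs (lBar_pos hs')

theorem tendsto_integral_zero {f : ℝ → ℝ} (hf : IntegrableOn f (Ioc 0 1)) :
    Tendsto (fun t => ∫ s in (0 : ℝ)..t, f s) (𝓝[>] 0) (𝓝 0) := by
  have h := (intervalIntegrable_of_integrableOn hf le_rfl zero_le_one
    le_rfl).absolutelyContinuousOnInterval_intervalIntegral (c := 0) left_mem_uIcc
  have h1 := h.continuousOn
  rw [uIcc_of_le zero_le_one] at h1
  have h2 := h1 0 (left_mem_Icc.2 zero_le_one)
  rw [ContinuousWithinAt, intervalIntegral.integral_same] at h2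
  exact h2.mono_left (nhdsWithin_le_of_mem (mem_of_superset (Ioo_mem_nhdsGT zero_lt_one)
    Ioo_subset_Icc_self))

/-- The initial term is at most `k(θ) + y(θ)² / (2θ)`, and its second summand is dominated by the
kinetic energy on `[0, θ]`; both vanish as `θ → 0`. -/
theorem IsH1Path.uBar_le_cost {y : ℝ → ℝ} (hy : IsH1Path y) (h0 : y 0 = 0) {t : ℝ}
    (ht : t ∈ Ioo (0 : ℝ) 1) : uBar (y t) t ≤ cost y 0 t := by
  obtain ⟨t₀, ht₀, h⟩ := hy.exists_uBar_le ht
  have h1 : ∀ᶠ θ in 𝓝[>] (0 : ℝ),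
      uBar (y t) t ≤ kBar θ + (∫ s in (0 : ℝ)..θ, deriv y s ^ 2 / 2) + cost y 0 t := by
    filter_upwards [eventually_aBar_pos, Ioo_mem_nhdsGT ht₀.1] with θ ha hθ
    have hθ1 : θ < 1 := (hθ.2.trans_le ht₀.2).trans ht.2
    have h2 := (h θ ⟨hθ.1, hθ.2.le.trans ht₀.2⟩).2 hθ.2.le
    have h3 := calib_le_add (z := y θ) ⟨hθ.1, hθ1⟩ ha
    have h4 := hy.sq_div_le_integral h0 hθ.1 hθ1.le
    have h5 := hy.cost_add le_rfl hθ.1.le (hθ.2.le.trans ht₀.2) ht.2.le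
    have h6 : 0 ≤ cost y 0 θ := intervalIntegral.integral_nonneg hθ.1.le fun s _ =>
      add_nonneg (by positivity) (rhoBar_nonneg _ _)
    linarith
  have hk : Tendsto kBar (𝓝[>] 0) (𝓝 0) := isProfile_bar.k_zero
  have h2 := (hk.add (tendsto_integral_zero
    (hy.integrableOn_deriv_sq.div_const 2))).add_const (cost y 0 t)
  simpa using ge_of_tendsto h2 h1

/-! ### Optimal paths -/

theorem isH1Path_of_hasDerivAt {y v : ℝ → ℝ} (hc : ContinuousOn y (Icc 0 1))
    (hd : ∀ s ∈ Ioo (0 : ℝ) 1, HasDerivAt y (v s) s) (hv : ContinuousOn v (Ioo 0 1))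
    (hi : IntegrableOn (fun s => v s ^ 2) (Ioc 0 1)) : IsH1Path y := by
  have h1 : MemLp v 2 (volume.restrict (Ioo 0 1)) :=
    (memLp_two_iff_integrable_sq (hv.aestronglyMeasurable measurableSet_Ioo)).2
      (hi.mono_set Ioo_subset_Ioc_self)
  refine ⟨absolutelyContinuousOnInterval_of_hasDerivAt zero_le_one hc hd ?_, h1.ae_eq ?_⟩
  · rw [intervalIntegrable_iff, uIoc_of_le zero_le_one, integrableOn_Ioc_iff_integrableOn_Ioo]
    exact h1.integrable one_le_two
  · filter_upwards [ae_restrict_mem measurableSet_Ioo] with s hs using (hd s hs).deriv.symm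

theorem IsH1Path.cost_eq_sub {y F : ℝ → ℝ} (hy : IsH1Path y) {a b : ℝ} (ha : 0 ≤ a) (hab : a ≤ b)
    (hb : b ≤ 1) (hF : ContinuousOn F (Icc a b))
    (hd : ∀ s ∈ Ioo a b, HasDerivAt F (deriv y s ^ 2 / 2 + rhoBar (y s) s) s) :
    cost y a b = F b - F a :=
  intervalIntegral.integral_eq_sub_of_hasDerivAt_of_le hab hF hd
    (intervalIntegrable_of_integrableOn hy.integrableOn_cost ha hab hb)

/-- The singularity of `a` cancels against `l²`, so the boundary value of `ū` extends continuously
to the times `0` and `1`. -/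
theorem uInner_lBar (s : ℝ) :
    uInner (lBar s) s = kBar s + π * radius ^ 2 * sin (phase s) := by
  unfold uInner aBar lBar
  rcases eq_or_ne (1 - cos (phase s)) 0 with h | h
  · have h1 := Real.sin_sq_add_cos_sq (phase s)
    have h2 : cos (phase s) = 1 := by linarith
    have h3 : sin (phase s) = 0 := by
      rw [h2] at h1
      exact pow_eq_zero_iff two_ne_zero |>.1 (by linarith)
    rw [h3]
    simp
  · field_simp

theorem continuous_uInner_lBar : Continuous fun s => uInner (lBar s) s := by
  simp_rw [uInner_lBar]
  have h1 := continuous_kBar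
  have h2 := phase_continuous
  fun_prop

theorem uInner_lBar_zero : uInner (lBar 0) 0 = 0 := by
  simp [uInner_lBar, kBar_zero, phase_zero]

theorem continuousOn_slope : ContinuousOn (fun s => aBar s * lBar s) (Ioo 0 1) :=
  continuousOn_aBar.mul lBar_continuous.continuousOn

/-- The boundary curve has finite kinetic energy: half the squared slope is the nonnegative
derivative of a function continuous on `[0,1]`. -/
theorem integrableOn_slope_sq : IntegrableOn (fun s => (aBar s * lBar s) ^ 2) (Ioc 0 1) := by
  have h := intervalIntegral.integrableOn_deriv_of_nonneg
    (continuous_uInner_lBar.continuousOn (s := Icc 0 1))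
    (fun s hs => hasDerivAt_uInner_lBar hs) fun s _ => by positivity
  refine (h.const_mul 2).congr (Eventually.of_forall fun s => ?_)
  simp only
  ring

theorem isH1Path_const_mul_lBar (c : ℝ) : IsH1Path fun s => c * lBar s := by
  refine isH1Path_of_hasDerivAt (continuousOn_const.mul lBar_continuous.continuousOn)
    (fun s hs => (hasDerivAt_lBar hs).const_mul c) (continuousOn_const.mul continuousOn_slope) ?_
  refine (integrableOn_slope_sq.const_mul (c ^ 2)).congr (Eventually.of_forall fun s => ?_)
  simp only
  ring

/-- On `c * l` the density is `(1 - c²) r`, so the running cost is a combination of the derivatives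
of `ū` along the boundary and of `k`. -/
theorem cost_const_mul_lBar {c : ℝ} (hc : |c| ≤ 1) {t : ℝ} (ht : t ∈ Ioo (0 : ℝ) 1) :
    cost (fun s => c * lBar s) 0 t = uInner (c * lBar t) t := by
  have hF : Continuous fun s => c ^ 2 * uInner (lBar s) s + (1 - c ^ 2) * kBar s :=
    (continuous_const.mul continuous_uInner_lBar).add (continuous_const.mul continuous_kBar)
  rw [(isH1Path_const_mul_lBar c).cost_eq_sub le_rfl ht.1.le ht.2.le hF.continuousOn]
  · simp only [uInner_lBar_zero, kBar_zero]
    unfold uInner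
    ring
  · intro s hs
    have hs1 : s ∈ Ioo (0 : ℝ) 1 := ⟨hs.1, hs.2.trans ht.2⟩
    refine (((hasDerivAt_uInner_lBar hs1).const_mul (c ^ 2)).add
      ((isProfile_bar.k_ode s hs1).const_mul (1 - c ^ 2))).congr_deriv ?_
    have hc2 : 0 ≤ 1 - c ^ 2 := by
      rw [sub_nonneg, sq_le_one_iff_abs_le_one]
      exact hc
    rw [((hasDerivAt_lBar hs1).const_mul c).deriv, rhoBar, mul_div_cancel_right₀ _ (lBar_pos hs1).ne',
      max_eq_left hc2]
    ring

/-- The path which follows the boundary of the support of the density up to the time `t₀` and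
then its tangent line. -/
noncomputable def tangentPath (t₀ s : ℝ) : ℝ :=
  if s ≤ t₀ then lBar s else lBar t₀ + (s - t₀) * (aBar t₀ * lBar t₀)

/-- The two pieces join with equal slope, and `min s t₀` covers both in one formula. -/
theorem hasDerivAt_tangentPath {t₀ : ℝ} (ht₀ : t₀ ∈ Ioo (0 : ℝ) 1) {s : ℝ}
    (hs : s ∈ Ioo (0 : ℝ) 1) :
    HasDerivAt (tangentPath t₀) (aBar (min s t₀) * lBar (min s t₀)) s := by
  have h1 : HasDerivAt (fun s => lBar t₀ + (s - t₀) * (aBar t₀ * lBar t₀))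
      (aBar t₀ * lBar t₀) s := by
    simpa using (((hasDerivAt_id s).sub_const t₀).mul_const (aBar t₀ * lBar t₀)).const_add (lBar t₀)
  rcases lt_trichotomy s t₀ with h | rfl | h
  · rw [min_eq_left h.le]
    refine (hasDerivAt_lBar hs).congr_of_eventuallyEq ?_
    filter_upwards [Iio_mem_nhds h] with u hu using if_pos (le_of_lt hu)
  · rw [min_self, ← hasDerivWithinAt_univ, ← Iic_union_Ici (a := s)]
    refine HasDerivWithinAt.union ?_ ?_
    · exact (hasDerivAt_lBar hs).hasDerivWithinAt.congr (fun u hu => if_pos hu) (if_pos le_rfl)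
    · refine h1.hasDerivWithinAt.congr (fun u hu => ?_) (by simp [tangentPath])
      rcases (show s ≤ u from hu).eq_or_lt with rfl | h
      · simp [tangentPath]
      · exact if_neg (not_le.2 h)
  · rw [min_eq_right h.le]
    refine h1.congr_of_eventuallyEq ?_
    filter_upwards [Ioi_mem_nhds h] with u hu using if_neg (not_le.2 hu)

theorem continuous_tangentPath (t₀ : ℝ) : Continuous (tangentPath t₀) := by
  refine Continuous.if_le lBar_continuous (by fun_prop) continuous_id continuous_const ?_
  rintro s rfl
  simp

theorem isH1Path_tangentPath {t₀ : ℝ} (ht₀ : t₀ ∈ Ioo (0 : ℝ) 1) : IsH1Path (tangentPath t₀) := by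
  have hmin : ∀ s ∈ Ioo (0 : ℝ) 1, min s t₀ ∈ Ioo (0 : ℝ) 1 := fun s hs =>
    ⟨lt_min hs.1 ht₀.1, min_lt_of_left_lt hs.2⟩
  have hv : ContinuousOn (fun s => aBar (min s t₀) * lBar (min s t₀)) (Ioo 0 1) :=
    continuousOn_slope.comp (by fun_prop) hmin
  refine isH1Path_of_hasDerivAt (continuous_tangentPath t₀).continuousOn
    (fun s hs => hasDerivAt_tangentPath ht₀ hs) hv ?_
  have h1 : IntegrableOn (fun s => (aBar s * lBar s) ^ 2 + (aBar t₀ * lBar t₀) ^ 2) (Ioc 0 1) :=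
    integrableOn_slope_sq.add (integrableOn_const (by simp))
  rw [integrableOn_Ioc_iff_integrableOn_Ioo] at h1 ⊢
  refine h1.mono' ((hv.pow 2).aestronglyMeasurable measurableSet_Ioo)
    (Eventually.of_forall fun s => ?_)
  rw [Real.norm_of_nonneg (by positivity)]
  rcases le_total s t₀ with h | h
  · rw [min_eq_left h]
    exact le_add_of_nonneg_right (by positivity)
  · rw [min_eq_right h]
    exact le_add_of_nonneg_left (by positivity)

theorem cost_tangentPath {t₀ t : ℝ} (ht₀ : t₀ ∈ Ioc 0 t) (ht : t < 1) :
    cost (tangentPath t₀) 0 t = tangentSol t₀ (tangentPath t₀ t) t := by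
  have ht₀1 : t₀ ∈ Ioo (0 : ℝ) 1 := ⟨ht₀.1, ht₀.2.trans_lt ht⟩
  have hy := isH1Path_tangentPath ht₀1
  -- By concavity the tangent line stays above `l`, so the path never enters the interior of the
  -- support.
  have hρ : ∀ s ∈ Ioo 0 t, rhoBar (tangentPath t₀ s) s = 0 := fun s hs => by
    have hs1 : s ∈ Ioo (0 : ℝ) 1 := ⟨hs.1, hs.2.trans ht⟩
    have hle : lBar s ≤ tangentPath t₀ s := by
      unfold tangentPath
      split_ifs with h
      · exact le_rfl
      · exact lBar_le_tangentLine ht₀.1 (not_le.1 h).le hs1.2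
    have h1 : 1 ≤ tangentPath t₀ s / lBar s := (one_le_div (lBar_pos hs1)).2 hle
    rw [rhoBar, max_eq_right (by nlinarith), mul_zero]
  have h1 : cost (tangentPath t₀) 0 t₀ = uInner (lBar t₀) t₀ - uInner (lBar 0) 0 := by
    refine hy.cost_eq_sub le_rfl ht₀.1.le ht₀1.2.le continuous_uInner_lBar.continuousOn
      fun s hs => ?_
    have hs1 : s ∈ Ioo (0 : ℝ) 1 := ⟨hs.1, hs.2.trans ht₀1.2⟩
    rw [hρ s ⟨hs.1, hs.2.trans_le ht₀.2⟩, (hasDerivAt_tangentPath ht₀1 hs1).deriv,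
      min_eq_left hs.2.le, add_zero]
    exact hasDerivAt_uInner_lBar hs1
  have h2 : cost (tangentPath t₀) t₀ t
      = (aBar t₀ * lBar t₀) ^ 2 / 2 * t - (aBar t₀ * lBar t₀) ^ 2 / 2 * t₀ := by
    refine hy.cost_eq_sub (F := fun s => (aBar t₀ * lBar t₀) ^ 2 / 2 * s) ht₀.1.le ht₀.2 ht.le
      (by fun_prop) fun s hs => ?_
    have hs1 : s ∈ Ioo (0 : ℝ) 1 := ⟨ht₀.1.trans hs.1, hs.2.trans ht⟩
    rw [hρ s ⟨hs1.1, hs.2⟩, (hasDerivAt_tangentPath ht₀1 hs1).deriv, min_eq_right hs.1.le, add_zero]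
    simpa using (hasDerivAt_id s).const_mul ((aBar t₀ * lBar t₀) ^ 2 / 2)
  have h3 : tangentPath t₀ t = lBar t₀ + (t - t₀) * (aBar t₀ * lBar t₀) := by
    unfold tangentPath
    split_ifs with h
    · rw [le_antisymm h ht₀.2]
      simp
    · rfl
  rw [← hy.cost_add le_rfl ht₀.1.le ht₀.2 ht.le, h1, h2, h3, uInner_lBar_zero]
  unfold tangentSol
  ring

/-- Optimal paths exist. -/
theorem exists_cost_eq_uBar {t : ℝ} (x : ℝ) (ht : t ∈ Ioo (0 : ℝ) 1) :
    ∃ y, IsH1Path y ∧ y t = x ∧ y 0 = 0 ∧ cost y 0 t = uBar x t := by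
  wlog hx : 0 ≤ x generalizing x
  · obtain ⟨y, hy, hyt, hy0, hc⟩ := this (-x) (by linarith)
    exact ⟨fun s => -y s, hy.neg, by simp [hyt], by simp [hy0], by rw [cost_neg, hc, uBar_neg]⟩
  have hl := lBar_pos ht
  rcases le_total x (lBar t) with h | h
  · have e : x / lBar t * lBar t = x := div_mul_cancel₀ x hl.ne'
    refine ⟨fun s => x / lBar t * lBar s, isH1Path_const_mul_lBar _, e, by simp [lBar_zero], ?_⟩
    rw [cost_const_mul_lBar _ ht, e, uBar_eq_uInner (by rwa [abs_of_nonneg hx])]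
    rw [abs_of_nonneg (by positivity)]
    exact (div_le_one hl).2 h
  · obtain ⟨t₀, ht₀, hxt₀, hu⟩ := exists_uBar_eq_tangentSol ht h
    have e : tangentPath t₀ t = x := by
      unfold tangentPath
      split_ifs with h'
      · rw [hxt₀, le_antisymm h' ht₀.2]
        simp
      · exact hxt₀.symm
    refine ⟨tangentPath t₀, isH1Path_tangentPath ⟨ht₀.1, ht₀.2.trans_lt ht.2⟩, e, ?_, ?_⟩
    · rw [tangentPath, if_pos ht₀.1.le, lBar_zero]
    · rw [cost_tangentPath ht₀ ht.2, e, hu]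

theorem isGLB_cost {t : ℝ} (x : ℝ) (ht : t ∈ Ioo (0 : ℝ) 1) :
    IsGLB {c : ℝ | ∃ y : ℝ → ℝ, IsH1Path y ∧ y t = x ∧ y 0 = 0 ∧ c = cost y 0 t} (uBar x t) := by
  constructor
  · rintro c ⟨y, hy, rfl, hy0, rfl⟩
    exact hy.uBar_le_cost hy0 ht
  · intro b hb
    obtain ⟨y, hy, hyt, hy0, hc⟩ := exists_cost_eq_uBar x ht
    exact hb ⟨y, hy, hyt, hy0, hc.symm⟩

theorem isGLB_cost_add_uBar {θ t : ℝ} (x : ℝ) (hθ : 0 < θ) (hθt : θ < t) (ht : t < 1) :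
    IsGLB {c : ℝ | ∃ y : ℝ → ℝ, IsH1Path y ∧ y t = x ∧ c = cost y θ t + uBar (y θ) θ}
      (uBar x t) := by
  have ht' : t ∈ Ioo (0 : ℝ) 1 := ⟨hθ.trans hθt, ht⟩
  constructor
  · rintro c ⟨y, hy, rfl, rfl⟩
    obtain ⟨t₀, -, h⟩ := hy.exists_uBar_le ht'
    rw [add_comm]
    exact (h θ ⟨hθ, hθt.le⟩).1
  · intro b hb
    obtain ⟨y, hy, hyt, hy0, hc⟩ := exists_cost_eq_uBar x ht'
    have h1 := hb ⟨y, hy, hyt, rfl⟩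
    -- The path optimal from time `0` is also optimal from `θ`: its cost up to `θ` is at least `ū(y
    -- θ, θ)`.
    have h2 := hy.uBar_le_cost hy0 ⟨hθ, hθt.trans ht⟩
    have h3 := hy.cost_add le_rfl hθ.le hθt.le ht.le
    linarith

/-! ### Comparison with the fundamental solution -/

theorem sq_div_le_uBar {t : ℝ} (x : ℝ) (ht : t ∈ Ioo (0 : ℝ) 1) : x ^ 2 / (2 * t) ≤ uBar x t := by
  obtain ⟨y, hy, rfl, hy0, hc⟩ := exists_cost_eq_uBar x ht
  rw [← hc]
  exact (hy.sq_div_le_integral hy0 ht.1 ht.2.le).trans (hy.integral_le_cost le_rfl ht.1.le ht.2.le)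

theorem uBar_le_sq_div_add {t : ℝ} (x : ℝ) (ht : t ∈ Ioo (0 : ℝ) 1) :
    uBar x t ≤ x ^ 2 / (2 * t) + kBar t := by
  have hd : ∀ s, HasDerivAt (fun s => x / t * s) (x / t) s := fun s => by
    simpa using (hasDerivAt_id s).const_mul (x / t)
  have hy : IsH1Path fun s => x / t * s :=
    isH1Path_of_hasDerivAt (v := fun _ => x / t) (by fun_prop) (fun s _ => hd s) continuousOn_const
      (integrableOn_const (by simp))
  have h1 := hy.uBar_le_cost (mul_zero _) ht
  rw [div_mul_cancel₀ x ht.1.ne'] at h1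
  refine h1.trans ?_
  have hi := intervalIntegrable_of_integrableOn integrableOn_rBar le_rfl ht.1.le ht.2.le
  have h2 : ∫ s in (0 : ℝ)..t, ((x / t) ^ 2 / 2 + rBar s) = x ^ 2 / (2 * t) + kBar t := by
    rw [intervalIntegral.integral_add intervalIntegrable_const hi, integral_rBar ht.1.le ht.2.le,
      intervalIntegral.integral_const, smul_eq_mul]
    have := ht.1
    field_simp
    ring
  rw [← h2]
  refine intervalIntegral.integral_mono_on ht.1.le
    (intervalIntegrable_of_integrableOn hy.integrableOn_cost le_rfl ht.1.le ht.2.le)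
    (intervalIntegrable_const.add hi) fun s _ => ?_
  rw [(hd s).deriv]
  gcongr
  exact rhoBar_le _ _

end Planning

theorem mainTheorem4 :
    -- the dynamic programming principle
    (∀ θ t x : ℝ, 0 < θ → θ < t → t < 1 →
      IsGLB {c : ℝ | ∃ y : ℝ → ℝ, Planning.IsH1Path y ∧ y t = x ∧
          c = Planning.cost y θ t + Planning.uBar (y θ) θ}
        (Planning.uBar x t)) ∧
    -- the optimal control formula
    (∀ t x : ℝ, 0 < t → t < 1 →
      IsGLB {c : ℝ | ∃ y : ℝ → ℝ, Planning.IsH1Path y ∧ y t = x ∧ y 0 = 0 ∧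
          c = Planning.cost y 0 t}
        (Planning.uBar x t)) ∧
    -- the lower bound
    (∀ t x : ℝ, 0 < t → t < 1 → x ^ 2 / (2 * t) ≤ Planning.uBar x t) ∧
    -- the upper limit at time zero is nonpositive, uniformly in space
    (∀ ε : ℝ, 0 < ε → ∃ δ : ℝ, 0 < δ ∧ δ ≤ 1 ∧ ∀ t x : ℝ, 0 < t → t < δ →
      Planning.uBar x t - x ^ 2 / (2 * t) ≤ ε) := by
  refine ⟨fun θ t x hθ hθt ht => Planning.isGLB_cost_add_uBar x hθ hθt ht,
    fun t x h0 ht => Planning.isGLB_cost x ⟨h0, ht⟩,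
    fun t x h0 ht => Planning.sq_div_le_uBar x ⟨h0, ht⟩, fun ε hε => ?_⟩
  -- The excess over `x² / (2t)` is at most `k(t)`, which does not involve `x`; hence the
  -- uniformity.
  obtain ⟨δ, hδ, h⟩ := mem_nhdsGT_iff_exists_Ioo_subset.1
    (Planning.isProfile_bar.k_zero.eventually_lt_const hε)
  refine ⟨min δ 1, lt_min hδ zero_lt_one, min_le_right _ _, fun t x h0 ht => ?_⟩
  have h1 := Planning.uBar_le_sq_div_add x ⟨h0, ht.trans_le (min_le_right _ _)⟩
  have h2 : Planning.kBar t < ε := h ⟨h0, ht.trans_le (min_le_left _ _)⟩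
  linarith
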